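/- Let $N\in\mathbb N$, let $\Omega\subset\mathbb R^N$ be a bounded open set, let $Y=Z=(-\tfrac12,\tfrac12)^N$, and let $(\varepsilon_n)_n$ be a sequence of positive numbers converging to $0$. Let $B:[0,\infty)\to[0,\infty)$ be an N-function, i.e. $B$ is continuous and convex, $B(t)>0$ for $t>0$, $B(t)/t\to0$ as $t\to0^+$ and $B(t)/t\to\infty$ as $t\to\infty$. Let $\widetilde B(t)=\sup_{s\ge0}(st-B(s))$ be its conjugate, and assume that both $B$ and $\widetilde B$ satisfy the $\Delta_2$ condition: a function $A$ satisfies it if there are $\alpha>0$, $t_0\ge0$ with $A(2t)\le\alpha A(t)$ for all $t\ge t_0$. Write $L^B(\Omega)$ for the space of measurable $u:\Omega\to\mathbb R$ with $\lim_{\delta\to0^+}\int_\Omega B(\delta|u|)\,dx=0$, with the norm $\|u\|_{B,\Omega}=\inf\{k>0:\int_\Omega B(|u|/k)\,dx\le1\}$; $L^B$ on other sets, and $L^B_{loc}$ (membership in $L^B(K)$ for every compact subset $K$), are defined likewise. Let $\mathcal C_{per}(Y\times Z)$ be the space of continuous $\mathbb Z^N\times\mathbb Z^N$-periodic functions on $\mathbb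 R^N\times\mathbb R^N$ with the sup norm, and let $L^{\widetilde B}(\Omega;\mathcal C_{per}(Y\times Z))$ be the space of strongly measurable $f:\Omega\to\mathcal C_{per}(Y\times Z)$ with $x\mapsto\|f(x)\|_\infty$ in $L^{\widetilde B}(\Omega)$. Let $L^B_{per}(\Omega\times Y\times Z)$ be the space of $v\in L^B_{loc}(\Omega\times\mathbb R^N\times\mathbb R^N)$ such that, for a.e. $x\in\Omega$, the function $v(x,\cdot,\cdot)$ belongs to $L^B_{loc}(\mathbb R^N\times\mathbb R^N)$ and is $\mathbb Z^N\times\mathbb Z^N$-periodic, and such that $\iiint_{\Omega\times Y\times Z}B(|v|)\,dx\,dy\,dz<\infty$. If $(u_n)_n$ is a bounded sequence in $L^B(\Omega)$, then there are a strictly increasing sequence of indices $(n_j)_j$ and a function $u_0\in L^B_{per}(\Omega\times Y\times Z)$ such that $(u_{n_j})_j$ converges to $u_0$ weakly reiteratively two-scale in $L^B(\Omega)$ along the scales $(\varepsilon_{n_j})_j$, that is, $$\lim_{j\to\infty}\int_\Omega u_{n_j}(x)\,f\Big(x,\frac{x}{\varepsilon_{n_j}},\frac{x}{\varepsilon_{n_j}^2}\Big)\,dx=\iiint_{\Omega\times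 Y\times Z}u_0(x,y,z)\,f(x,y,z)\,dx\,dy\,dz$$ for every $f\in L^{\widetilde B}(\Omega;\mathcal C_{per}(Y\times Z))$. -/

import Mathlib

open MeasureTheory Filter Topology Set
open scoped ENNReal NNReal

namespace ReiteratedOrlicz

/-- `B : [0,∞) → [0,∞)` is an N-function. Only the values of `B` on `[0,∞)` matter; `B 0 = 0` follows
from continuity and the behaviour of `B t / t` at `0`. -/
structure IsNFunction (B : ℝ → ℝ) : Prop where
  continuousOn : ContinuousOn B (Ici 0)
  convexOn : ConvexOn ℝ (Ici 0) B
  pos : ∀ t, 0 < t → 0 < B t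
  tendsto_zero : Tendsto (fun t => B t / t) (𝓝[>] 0) (𝓝 0)
  tendsto_atTop : Tendsto (fun t => B t / t) atTop atTop

/-- The complementary function `B̃ t = sup_{s ≥ 0} (s t - B s)`; for an N-function `B` and `t ≥ 0`
the supremum is over a nonempty set that is bounded above. -/
noncomputable def conj (B : ℝ → ℝ) (t : ℝ) : ℝ :=
  sSup ((fun s => s * t - B s) '' Ici 0)

/-- The `Δ₂` condition (at infinity). -/
def Delta2 (B : ℝ → ℝ) : Prop :=
  ∃ α > 0, ∃ t₀ ≥ 0, ∀ t ≥ t₀, B (2 * t) ≤ α * B t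

section Orlicz

variable {α : Type*} [MeasurableSpace α]

/-- Membership in the Orlicz space `L^B(μ)`: `u` is (a.e.-)measurable and
`∫ B(δ|u|) dμ → 0` as `δ → 0⁺`. -/
def MemOrlicz (B : ℝ → ℝ) (μ : Measure α) (u : α → ℝ) : Prop :=
  AEStronglyMeasurable u μ ∧
    Tendsto (fun δ : ℝ => ∫⁻ x, ENNReal.ofReal (B (δ * |u x|)) ∂μ) (𝓝[>] 0) (𝓝 0)

/-- The Luxemburg norm `inf {k > 0 : ∫ B(|u|/k) dμ ≤ 1}`, with values in `[0,∞]`. -/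
noncomputable def luxNorm (B : ℝ → ℝ) (μ : Measure α) (u : α → ℝ) : ℝ≥0∞ :=
  ⨅ (k : ℝ) (_ : 0 < k ∧ ∫⁻ x, ENNReal.ofReal (B (|u x| / k)) ∂μ ≤ 1), ENNReal.ofReal k

end Orlicz

/-- `u ∈ L^B_loc(U)`: `u ∈ L^B(K)` for every compact `K ⊆ U`. -/
def MemOrliczLoc {α : Type*} [TopologicalSpace α] [MeasureSpace α]
    (B : ℝ → ℝ) (U : Set α) (u : α → ℝ) : Prop :=
  ∀ K ⊆ U, IsCompact K → MemOrlicz B (volume.restrict K) u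

/-- `ℝ^N`. -/
abbrev E (N : ℕ) : Type := EuclideanSpace ℝ (Fin N)

/-- The reference cell `(-1/2, 1/2)^N`, used both as `Y` and as `Z`. -/
def cell (N : ℕ) : Set (E N) :=
  {y | ∀ i, y i ∈ Ioo (-(1 / 2) : ℝ) (1 / 2)}

/-- An integer vector regarded as an element of `ℝ^N`. -/
def intVec {N : ℕ} (k : Fin N → ℤ) : E N :=
  WithLp.toLp 2 (fun i => (k i : ℝ))

/-- `C_per(Y × Z)`: the continuous `ℤ^N × ℤ^N`-periodic functions on `ℝ^N × ℝ^N`, with the sup norm.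
(Such functions are automatically bounded, so this is a subspace of the bounded continuous
functions.) -/
def Cper (N : ℕ) : Submodule ℝ (BoundedContinuousFunction (E N × E N) ℝ) where
  carrier := {w | ∀ (k h : Fin N → ℤ) (y z : E N), w (y + intVec k, z + intVec h) = w (y, z)}
  add_mem' := by
    intro a b ha hb k h y z
    simp only [BoundedContinuousFunction.add_apply, ha k h y z, hb k h y z]
  zero_mem' := by
    intro k h y z
    rfl
  smul_mem' := by
    intro c a ha k h y z
    simp only [BoundedContinuousFunction.smul_apply, ha k h y z]

/-- `f ∈ L^B(Ω; C_per(Y × Z))`: `f` is strongly measurable (Bochner) with values in the Banach space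
`C_per(Y × Z)`, and `x ↦ ‖f x‖_∞` belongs to `L^B(Ω)`. -/
def MemOrliczCper {N : ℕ} (B : ℝ → ℝ) (Ω : Set (E N)) (f : E N → Cper N) : Prop :=
  AEStronglyMeasurable f (volume.restrict Ω) ∧ MemOrlicz B (volume.restrict Ω) (fun x => ‖f x‖)

/-- The trace `f^ε(x) = f(x, x/ε, x/ε²)`. -/
noncomputable def trace {N : ℕ} (ε : ℝ) (f : E N → Cper N) (x : E N) : ℝ :=
  (f x : BoundedContinuousFunction (E N × E N) ℝ) (ε⁻¹ • x, (ε ^ 2)⁻¹ • x)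

/-- `w ∈ L^B_per(Y × Z)`: `w ∈ L^B_loc(ℝ^N × ℝ^N)` and `w` is `ℤ^N × ℤ^N`-periodic
(as an a.e.-class). -/
def MemOrliczPer {N : ℕ} (B : ℝ → ℝ) (w : E N × E N → ℝ) : Prop :=
  MemOrliczLoc B univ w ∧
    ∀ k h : Fin N → ℤ, ∀ᵐ q : E N × E N, w (q.1 + intVec k, q.2 + intVec h) = w q

/-- `v ∈ L^B_per(Ω × Y × Z)`: `v ∈ L^B_loc(Ω × ℝ^N × ℝ^N)`, `v(x,·,·) ∈ L^B_per(Y × Z)` for a.e.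
`x ∈ Ω`, and `∫∫∫_{Ω×Y×Z} B(|v|) < ∞`. -/
structure MemOrliczPer₃ {N : ℕ} (B : ℝ → ℝ) (Ω : Set (E N)) (v : E N × E N × E N → ℝ) : Prop where
  loc : MemOrliczLoc B (Ω ×ˢ univ) v
  per : ∀ᵐ x ∂(volume.restrict Ω), MemOrliczPer B (fun q => v (x, q))
  integral_lt_top :
    ∫⁻ p in Ω ×ˢ cell N ×ˢ cell N, ENNReal.ofReal (B |v p|) < ∞

/-- The sequence `u n ∈ L^B(Ω)`, attached to the scales `ε n`, converges weakly reiteratively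
two-scale in `L^B(Ω)` to `u₀ ∈ L^B_per(Ω × Y × Z)`. The integrands below are integrable because
of the membership conditions (Young's inequality `s t ≤ B s + B̃ t`). -/
structure WeakReiteratedTwoScale {N : ℕ} (B : ℝ → ℝ) (Ω : Set (E N)) (ε : ℕ → ℝ)
    (u : ℕ → E N → ℝ) (u₀ : E N × E N × E N → ℝ) : Prop where
  mem_seq : ∀ n, MemOrlicz B (volume.restrict Ω) (u n)
  mem_limit : MemOrliczPer₃ B Ω u₀
  tendsto : ∀ f : E N → Cper N, MemOrliczCper (conj B) Ω f →
    Tendsto (fun n => ∫ x in Ω, u n x * trace (ε n) f x) atTop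
      (𝓝 (∫ p in Ω ×ˢ cell N ×ˢ cell N,
        u₀ p * (f p.1 : BoundedContinuousFunction (E N × E N) ℝ) p.2))

end ReiteratedOrlicz

/-!
A sequence that is bounded in `L^B(Ω)` is tested against traces `f (x, x / ε, x / ε²)`. Reading periodic
functions as functions on the torus `S = (ℝ/ℤ)^N × (ℝ/ℤ)^N`, this is a statement about maps
`τ n : Ω → S`, and the only property of them that matters is the mean value property `Mixing`: for
`φ ∈ L¹(Ω)` and `w ∈ C(S)`, the integrals `∫ φ x * w (τ n x)` tend to `∫ φ * ∫ w`. For a character `w`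
this is the Riemann–Lebesgue lemma, because the frequency `k / ε + l / ε²` tends to infinity unless
`k = l = 0`; characters span a dense subspace of `C(S)` (`mixing_scalePoint`).

For such maps the compactness is obtained without the duality of Orlicz spaces
(`IsNFunction.exists_subseq_tendsto`). The truncations of `u n` at an integer height `m` define
functionals on the separable space `L¹(Ω; C(S))` that are bounded uniformly in `n`, so a diagonal
subsequence converges for all `m` at once. By the mean value property the limit functional is bounded by
the `L¹(Ω × S)` norm of the test function; it therefore extends to `L²(Ω × S)` and the Riesz
representation theorem gives a function `h m`. As `B` is superlinear, the sequence `u n` is uniformly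
integrable, so `h m` is Cauchy in `L¹` and its limit `h` represents the limit of the untruncated
integrals for bounded continuous test functions.

The modular of `h` is bounded by passing to the limit in Young's inequality and then choosing the test
function that realizes equality in it
(`IsNFunction.lintegral_le_one_of_forall_boundedContinuous`). General test functions are approximated in
modular by bounded continuous ones (`IsNFunction.exists_boundedContinuous_conj_le`), the error being
controlled uniformly in `n` by Young's inequality. The `Δ₂` condition on the conjugate makes every
multiple of a test function have finite modular, and the one on `B` removes the scaling constant from
the modular bound on `h`.
-/

namespace ReiteratedOrlicz

/-! ### N-functions and their conjugates -/

section NFunction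

variable {B : ℝ → ℝ}

theorem IsNFunction.map_zero (hB : IsNFunction B) : B 0 = 0 := by
  have h1 : Tendsto B (𝓝[>] 0) (𝓝 (B 0)) :=
    (hB.continuousOn 0 self_mem_Ici).mono_left (nhdsWithin_mono _ Ioi_subset_Ici_self)
  have h2 : Tendsto (fun t => B t / t * t) (𝓝[>] 0) (𝓝 (0 * 0)) :=
    hB.tendsto_zero.mul (tendsto_id.mono_left nhdsWithin_le_nhds)
  have h3 : Tendsto B (𝓝[>] 0) (𝓝 (0 * 0)) := by
    refine h2.congr' ?_
    filter_upwards [self_mem_nhdsWithin] with t ht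
    exact div_mul_cancel₀ _ (ne_of_gt ht)
  simpa using tendsto_nhds_unique h1 h3

theorem IsNFunction.nonneg (hB : IsNFunction B) {t : ℝ} (ht : 0 ≤ t) : 0 ≤ B t := by
  rcases ht.eq_or_lt with rfl | h
  · exact hB.map_zero.ge
  · exact (hB.pos t h).le

theorem IsNFunction.map_mul_le (hB : IsNFunction B) {δ t : ℝ} (h0 : 0 ≤ δ) (h1 : δ ≤ 1)
    (ht : 0 ≤ t) : B (δ * t) ≤ δ * B t := by
  have := hB.convexOn.2 (show t ∈ Ici (0 : ℝ) from ht) (self_mem_Ici (a := (0 : ℝ)))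
    h0 (sub_nonneg.2 h1) (by ring)
  simpa [hB.map_zero] using this

theorem IsNFunction.monotoneOn (hB : IsNFunction B) : MonotoneOn B (Ici 0) := by
  intro s hs t ht hst
  rcases (show (0 : ℝ) ≤ t from ht).eq_or_lt with rfl | h
  · rw [le_antisymm hst hs]
  · have h1 : s / t ≤ 1 := (div_le_one h).2 hst
    have h2 := hB.map_mul_le (div_nonneg hs h.le) h1 h.le
    rw [div_mul_cancel₀ _ h.ne'] at h2
    exact h2.trans (mul_le_of_le_one_left (hB.nonneg ht) h1)

theorem IsNFunction.continuous_abs (hB : IsNFunction B) : Continuous fun t => B |t| :=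
  hB.continuousOn.comp_continuous _root_.continuous_abs fun t => abs_nonneg t

theorem IsNFunction.convexOn_abs (hB : IsNFunction B) : ConvexOn ℝ univ fun t => B |t| := by
  refine ⟨convex_univ, fun s _ t _ a b ha hb hab => ?_⟩
  refine (hB.monotoneOn (mem_Ici.2 (abs_nonneg _))
    (mem_Ici.2 (show (0 : ℝ) ≤ a • |s| + b • |t| by positivity)) ?_).trans
    (hB.convexOn.2 (abs_nonneg s) (abs_nonneg t) ha hb hab)
  refine (abs_add_le _ _).trans ?_
  simp [abs_mul, abs_of_nonneg ha, abs_of_nonneg hb]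

theorem IsNFunction.exists_le_mul (hB : IsNFunction B) {δ : ℝ} (hδ : 0 < δ) :
    ∃ M ≥ 0, ∀ t ≥ M, t ≤ δ * B t := by
  obtain ⟨M, hM⟩ := eventually_atTop.1 (hB.tendsto_atTop.eventually_ge_atTop (1 / δ))
  refine ⟨max M 0, le_max_right _ _, fun t ht => ?_⟩
  have h0 : 0 ≤ t := (le_max_right _ _).trans ht
  rcases h0.eq_or_lt with rfl | h
  · simp [hB.map_zero]
  · have := hM t ((le_max_left _ _).trans ht)
    rw [div_le_div_iff₀ hδ h] at this
    linarith

theorem IsNFunction.bddAbove_conj (hB : IsNFunction B) (t : ℝ) :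
    BddAbove ((fun s => s * t - B s) '' Ici 0) := by
  obtain ⟨M, hM0, hM⟩ := hB.exists_le_mul (δ := 1 / (|t| + 1)) (by positivity)
  refine ⟨M * |t|, ?_⟩
  rintro _ ⟨s, hs, rfl⟩
  have hs : 0 ≤ s := hs
  have h1 : s * t ≤ s * |t| := mul_le_mul_of_nonneg_left (le_abs_self t) hs
  rcases le_total s M with h | h
  · have := hB.nonneg hs
    have := mul_le_mul_of_nonneg_right h (abs_nonneg t)
    simp only
    linarith
  · have h2 := hM s h
    rw [one_div, ← div_eq_inv_mul, le_div_iff₀ (by positivity)] at h2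
    have := mul_nonneg hM0 (abs_nonneg t)
    simp only
    nlinarith

/-- Young's inequality for an N-function and its conjugate. -/
theorem IsNFunction.young (hB : IsNFunction B) {s : ℝ} (hs : 0 ≤ s) (t : ℝ) :
    s * t ≤ B s + conj B t := by
  have := le_csSup (hB.bddAbove_conj t) (mem_image_of_mem (fun s => s * t - B s) hs)
  unfold conj
  linarith

theorem conj_le {t c : ℝ} (h : ∀ s, 0 ≤ s → s * t - B s ≤ c) : conj B t ≤ c :=
  csSup_le (nonempty_Ici.image _) (by rintro _ ⟨s, hs, rfl⟩; exact h s hs)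

theorem IsNFunction.conj_nonneg (hB : IsNFunction B) (t : ℝ) : 0 ≤ conj B t := by
  have := hB.young le_rfl t
  rw [hB.map_zero] at this
  linarith

theorem IsNFunction.conj_zero (hB : IsNFunction B) : conj B 0 = 0 :=
  le_antisymm (conj_le fun s hs => by simpa using hB.nonneg hs) (hB.conj_nonneg 0)

theorem IsNFunction.conj_mono (hB : IsNFunction B) : Monotone (conj B) := fun t t' h =>
  conj_le fun s hs => by
    have := hB.young hs t'
    have := mul_le_mul_of_nonneg_left h hs
    linarith

theorem IsNFunction.convexOn_conj (hB : IsNFunction B) : ConvexOn ℝ univ (conj B) := by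
  refine ⟨convex_univ, fun t _ t' _ a b ha hb hab => conj_le fun s hs => ?_⟩
  have h1 := mul_le_mul_of_nonneg_left (hB.young hs t) ha
  have h2 := mul_le_mul_of_nonneg_left (hB.young hs t') hb
  have h3 : a * B s + b * B s = B s := by rw [← add_mul, hab, one_mul]
  simp only [smul_eq_mul]
  nlinarith

theorem IsNFunction.continuous_conj (hB : IsNFunction B) : Continuous (conj B) :=
  continuousOn_univ.1 (hB.convexOn_conj.continuousOn isOpen_univ)

/-- The equality case of Young's inequality: `b` is a measurable selection of the subdifferential of
the even function `t ↦ B |t|`, namely its right derivative. -/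
theorem IsNFunction.exists_young_eq (hB : IsNFunction B) :
    ∃ b : ℝ → ℝ, Measurable b ∧ (∀ t, B |t| + conj B |b t| ≤ t * b t) ∧
      ∀ m t, |t| ≤ m → |b t| ≤ B (m + 1) := by
  set A : ℝ → ℝ := fun t => B |t| with hA
  have hc : ConvexOn ℝ univ A := hB.convexOn_abs
  have hsub : ∀ t s, derivWithin A (Ioi t) t * (s - t) + A t ≤ A s := by
    intro t s
    rcases lt_trichotomy t s with h | rfl | h
    · have := hc.rightDeriv_le_slope_of_mem_interior (x := t) (by simp) (mem_univ s) h
      rw [slope_def_field, le_div_iff₀ (sub_pos.2 h)] at this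
      linarith
    · simp
    · have := (hc.slope_le_leftDeriv_of_mem_interior (x := s) (y := t) (mem_univ s) (by simp) h).trans
        (hc.leftDeriv_le_rightDeriv_of_mem_interior (by simp))
      rw [slope_def_field, div_le_iff₀ (sub_pos.2 h)] at this
      linarith
  refine ⟨fun t => derivWithin A (Ioi t) t, measurable_derivWithin_Ioi A, fun t => ?_,
    fun m t ht => ?_⟩
  · have : conj B |derivWithin A (Ioi t) t| ≤ t * derivWithin A (Ioi t) t - A t := by
      refine conj_le fun s hs => ?_
      rcases le_total 0 (derivWithin A (Ioi t) t) with h | h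
      · have := hsub t s
        rw [show A s = B s from congrArg B (abs_of_nonneg hs)] at this
        rw [abs_of_nonneg h]
        nlinarith
      · have := hsub t (-s)
        rw [show A (-s) = B s from congrArg B (by rw [abs_neg, abs_of_nonneg hs])] at this
        rw [abs_of_nonpos h]
        nlinarith
    linarith
  · have hm : 0 ≤ m := (abs_nonneg t).trans ht
    have h0 : 0 ≤ A t := hB.nonneg (abs_nonneg t)
    have key : ∀ s, |s - t| ≤ 1 → A s ≤ B (m + 1) := fun s hs =>
      hB.monotoneOn (abs_nonneg s) (show (0 : ℝ) ≤ m + 1 by linarith) (by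
        have := abs_add_le (s - t) t
        rw [sub_add_cancel] at this
        linarith)
    have h1 := hsub t (t + 1)
    have h2 := hsub t (t - 1)
    have h3 := key (t + 1) (by simp)
    have h4 := key (t - 1) (by simp)
    rw [abs_le]
    constructor <;> nlinarith

end NFunction

/-! ### Modulars and the Luxemburg norm -/

section Modular

variable {α : Type*} [MeasurableSpace α] {μ : Measure α} {A B : ℝ → ℝ}

/-- Under the `Δ₂` condition on a finite measure space, finiteness of the modular of one positive
multiple of `g` gives finiteness for all multiples. -/
theorem Delta2.lintegral_lt_top [IsFiniteMeasure μ] (hA2 : Delta2 A) (hA : MonotoneOn A (Ici 0))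
    {g : α → ℝ} (hg : ∀ x, 0 ≤ g x) {δ : ℝ} (hδ : 0 < δ)
    (h : ∫⁻ x, ENNReal.ofReal (A (δ * g x)) ∂μ < ∞) {c : ℝ} (hc : 0 ≤ c) :
    ∫⁻ x, ENNReal.ofReal (A (c * g x)) ∂μ < ∞ := by
  obtain ⟨a, ha, t₀, ht₀, hat⟩ := hA2
  -- Doubling the multiple keeps the modular finite; below the threshold `t₀` use monotonicity.
  have hdouble : ∀ d : ℝ, 0 ≤ d → ∫⁻ x, ENNReal.ofReal (A (d * g x)) ∂μ < ∞ →
      ∫⁻ x, ENNReal.ofReal (A (2 * d * g x)) ∂μ < ∞ := by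
    intro d hd hdfin
    have hpt : ∀ x, ENNReal.ofReal (A (2 * d * g x)) ≤
        ENNReal.ofReal a * ENNReal.ofReal (A (d * g x)) + ENNReal.ofReal (A (2 * t₀)) := by
      intro x
      have h0 : 0 ≤ d * g x := mul_nonneg hd (hg x)
      rcases le_total t₀ (d * g x) with hx | hx
      · refine le_add_right ?_
        rw [← ENNReal.ofReal_mul ha.le, mul_assoc]
        exact ENNReal.ofReal_le_ofReal (hat _ hx)
      · refine le_add_left (ENNReal.ofReal_le_ofReal (hA ?_ ?_ ?_))
        · exact mem_Ici.2 (by rw [mul_assoc]; positivity)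
        · exact mem_Ici.2 (by positivity)
        · rw [mul_assoc]; linarith
    refine (lintegral_mono hpt).trans_lt ?_
    rw [lintegral_add_right _ measurable_const, lintegral_const_mul' _ _ ENNReal.ofReal_ne_top,
      lintegral_const]
    exact ENNReal.add_lt_top.2 ⟨ENNReal.mul_lt_top ENNReal.ofReal_lt_top hdfin,
      ENNReal.mul_lt_top ENNReal.ofReal_lt_top (measure_lt_top _ _)⟩
  have hpow : ∀ j : ℕ, ∫⁻ x, ENNReal.ofReal (A (2 ^ j * δ * g x)) ∂μ < ∞ := by
    intro j
    induction j with
    | zero => simpa using h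
    | succ j ih =>
      have := hdouble (2 ^ j * δ) (by positivity) ih
      rwa [← mul_assoc, ← pow_succ'] at this
  obtain ⟨j, hj⟩ := pow_unbounded_of_one_lt (c / δ) (one_lt_two (α := ℝ))
  refine lt_of_le_of_lt (lintegral_mono fun x => ENNReal.ofReal_le_ofReal (hA ?_ ?_ ?_)) (hpow j)
  · exact mem_Ici.2 (mul_nonneg hc (hg x))
  · exact mem_Ici.2 (mul_nonneg (by positivity) (hg x))
  · exact mul_le_mul_of_nonneg_right ((div_lt_iff₀ hδ).1 hj).le (hg x)

theorem IsNFunction.memOrlicz_of_lintegral_lt_top (hB : IsNFunction B) {u : α → ℝ}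
    (hu : AEStronglyMeasurable u μ) (h : ∫⁻ x, ENNReal.ofReal (B |u x|) ∂μ < ∞) :
    MemOrlicz B μ u := by
  refine ⟨hu, ?_⟩
  set I := ∫⁻ x, ENNReal.ofReal (B |u x|) ∂μ with hI
  have hlim : Tendsto (fun δ : ℝ => ENNReal.ofReal δ * I) (𝓝[>] 0) (𝓝 0) := by
    have h1 : Tendsto (fun δ : ℝ => ENNReal.ofReal δ) (𝓝[>] 0) (𝓝 0) := by
      have := (ENNReal.continuous_ofReal.tendsto 0).mono_left
        (nhdsWithin_le_nhds (s := Ioi (0 : ℝ)))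
      simpa using this
    have := ENNReal.Tendsto.mul_const (b := I) h1 (Or.inr h.ne)
    simpa using this
  refine tendsto_of_tendsto_of_tendsto_of_le_of_le' tendsto_const_nhds hlim
    (Eventually.of_forall fun _ => zero_le) ?_
  filter_upwards [Ioc_mem_nhdsGT (zero_lt_one (α := ℝ))] with δ hδ
  rw [hI, ← lintegral_const_mul' _ _ ENNReal.ofReal_ne_top]
  refine lintegral_mono fun x => ?_
  rw [← ENNReal.ofReal_mul hδ.1.le]
  exact ENNReal.ofReal_le_ofReal (hB.map_mul_le hδ.1.le hδ.2 (abs_nonneg _))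

theorem MemOrlicz.exists_lintegral_lt_top {u : α → ℝ} (hu : MemOrlicz A μ u) :
    ∃ δ > 0, ∫⁻ x, ENNReal.ofReal (A (δ * |u x|)) ∂μ < ∞ := by
  have h := hu.2.eventually_lt_const (zero_lt_one (α := ℝ≥0∞))
  obtain ⟨δ, h1, h2⟩ := (h.and self_mem_nhdsWithin).exists
  exact ⟨δ, h2, h1.trans ENNReal.one_lt_top⟩

theorem IsNFunction.lintegral_le_one_of_luxNorm_lt (hB : IsNFunction B) {u : α → ℝ} {K : ℝ}
    (hK : luxNorm B μ u < ENNReal.ofReal K) :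
    ∫⁻ x, ENNReal.ofReal (B (|u x| / K)) ∂μ ≤ 1 := by
  unfold luxNorm at hK
  simp only [iInf_lt_iff] at hK
  obtain ⟨k, ⟨hk0, hk⟩, hkK⟩ := hK
  have hkK' : k < K := (ENNReal.ofReal_lt_ofReal_iff_of_nonneg hk0.le).1 hkK
  refine (lintegral_mono fun x => ENNReal.ofReal_le_ofReal (hB.monotoneOn ?_ ?_ ?_)).trans hk
  · exact mem_Ici.2 (div_nonneg (abs_nonneg _) (hk0.trans hkK').le)
  · exact mem_Ici.2 (div_nonneg (abs_nonneg _) hk0.le)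
  · exact div_le_div_of_nonneg_left (abs_nonneg _) hk0 hkK'.le

end Modular

/-! ### Limits of approximated sequences and extraction of subsequences -/

section Limits

/-- A sequence that is uniformly approximated by convergent sequences, with limits close to `l`,
converges to `l`. -/
theorem tendsto_of_forall_dist_approx {G : Type*} [PseudoMetricSpace G] {a : ℕ → G} {l : G}
    (h : ∀ η > 0, ∃ (b : ℕ → G) (m : G), Tendsto b atTop (𝓝 m) ∧ (∀ n, dist (a n) (b n) ≤ η) ∧
      dist l m ≤ η) : Tendsto a atTop (𝓝 l) := by
  refine Metric.tendsto_atTop.2 fun r hr => ?_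
  obtain ⟨b, m, hb, h1, h2⟩ := h (r / 4) (by positivity)
  obtain ⟨n₀, hn₀⟩ := Metric.tendsto_atTop.1 hb (r / 4) (by positivity)
  refine ⟨n₀, fun n hn => ?_⟩
  have h3 := hn₀ n hn
  have h4 := h1 n
  have h5 := dist_triangle4_right (a n) l (b n) m
  linarith

theorem tendsto_of_forall_approx {a : ℕ → ℝ} {l : ℝ}
    (h : ∀ η > 0, ∃ (b : ℕ → ℝ) (m : ℝ), Tendsto b atTop (𝓝 m) ∧ (∀ n, |a n - b n| ≤ η) ∧
      |l - m| ≤ η) : Tendsto a atTop (𝓝 l) :=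
  tendsto_of_forall_dist_approx h

theorem exists_tendsto_of_forall_approx {a : ℕ → ℝ}
    (h : ∀ η > 0, ∃ (b : ℕ → ℝ) (m : ℝ), Tendsto b atTop (𝓝 m) ∧ ∀ n, |a n - b n| ≤ η) :
    ∃ l, Tendsto a atTop (𝓝 l) := by
  refine cauchySeq_tendsto_of_complete (Metric.cauchySeq_iff'.2 fun r hr => ?_)
  obtain ⟨b, m, hb, h1⟩ := h (r / 4) (by positivity)
  obtain ⟨n₀, hn₀⟩ := Metric.cauchySeq_iff'.1 hb.cauchySeq (r / 4) (by positivity)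
  refine ⟨n₀, fun n hn => ?_⟩
  have h3 := hn₀ n hn
  have h4 := h1 n
  have h5 := h1 n₀
  rw [Real.dist_eq] at *
  rw [abs_le] at h4 h5
  rw [abs_lt] at h3 ⊢
  constructor <;> linarith

/-- Diagonal extraction: countably many pointwise bounded sequences of functions on a separable
space, each equi-Lipschitz, converge pointwise along a common subsequence. -/
theorem exists_subseq_forall_tendsto {V : Type*} [PseudoMetricSpace V]
    [TopologicalSpace.SeparableSpace V] [Nonempty V] {F : ℕ → ℕ → V → ℝ} {c : ℕ → ℝ}
    (hF : ∀ n m v w, |F n m v - F n m w| ≤ c m * dist v w)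
    (hbd : ∀ m v, ∃ R, ∀ n, |F n m v| ≤ R) :
    ∃ φ : ℕ → ℕ, StrictMono φ ∧ ∀ m v, ∃ l, Tendsto (fun j => F (φ j) m v) atTop (𝓝 l) := by
  choose R hR using hbd
  have hK : IsCompact (univ.pi fun i : ℕ × ℕ =>
      Icc (-(R i.1 (TopologicalSpace.denseSeq V i.2))) (R i.1 (TopologicalSpace.denseSeq V i.2))) :=
    isCompact_univ_pi fun _ => isCompact_Icc
  obtain ⟨l, -, φ, hφ, hl⟩ := hK.tendsto_subseq
    (x := fun n (i : ℕ × ℕ) => F n i.1 (TopologicalSpace.denseSeq V i.2))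
    fun n i _ => abs_le.1 (hR _ _ n)
  rw [tendsto_pi_nhds] at hl
  refine ⟨φ, hφ, fun m v => exists_tendsto_of_forall_approx fun η hη => ?_⟩
  obtain ⟨k, hk⟩ := (TopologicalSpace.denseRange_denseSeq V).exists_dist_lt v
    (ε := η / (|c m| + 1)) (by positivity)
  refine ⟨_, _, hl (m, k), fun n => (hF _ _ _ _).trans ?_⟩
  rw [lt_div_iff₀ (by positivity)] at hk
  have h1 : c m * dist v (TopologicalSpace.denseSeq V k) ≤
      |c m| * dist v (TopologicalSpace.denseSeq V k) :=
    mul_le_mul_of_nonneg_right (le_abs_self _) dist_nonneg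
  have h2 : 0 ≤ dist v (TopologicalSpace.denseSeq V k) := dist_nonneg
  simp only
  linarith

end Limits

/-! ### Truncation -/

/-- The truncation of `t` at height `R`, i.e. the projection of `t` to `[-R, R]`. -/
noncomputable def clamp (R t : ℝ) : ℝ := max (-R) (min t R)

theorem continuous_clamp (R : ℝ) : Continuous (clamp R) := by
  unfold clamp
  fun_prop

theorem abs_clamp_le {R : ℝ} (hR : 0 ≤ R) (t : ℝ) : |clamp R t| ≤ R :=
  abs_le.2 ⟨le_max_left _ _, max_le (by linarith) (min_le_right _ _)⟩

theorem clamp_of_abs_le {R t : ℝ} (h : |t| ≤ R) : clamp R t = t := by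
  rw [abs_le] at h
  rw [clamp, min_eq_left h.2, max_eq_right h.1]

theorem abs_sub_clamp_le {R : ℝ} (hR : 0 ≤ R) (t : ℝ) : |t - clamp R t| ≤ |t| := by
  rcases le_total |t| R with h | h
  · simp [clamp_of_abs_le h]
  · rcases le_total 0 t with ht | ht
    · rw [abs_of_nonneg ht] at h
      rw [clamp, min_eq_right h, max_eq_right (by linarith), abs_of_nonneg ht, abs_le]
      constructor <;> linarith
    · rw [abs_of_nonpos ht] at h
      rw [clamp, min_eq_left (by linarith), max_eq_left (by linarith), abs_of_nonpos ht, abs_le]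
      constructor <;> linarith

/-! ### Density of bounded continuous functions -/

section Density

variable {Y : Type*} [TopologicalSpace Y] [TopologicalSpace.PseudoMetrizableSpace Y]
  [MeasurableSpace Y] [BorelSpace Y] [SecondCountableTopology Y]
  {G : Type*} [NormedAddCommGroup G] [NormedSpace ℝ G]

theorem exists_boundedContinuous_tendsto_ae {ν : Measure Y} [IsFiniteMeasure ν] {f : Y → G}
    (hf : Integrable f ν) : ∃ F : ℕ → BoundedContinuousFunction Y G,
      ∀ᵐ y ∂ν, Tendsto (fun k => F k y) atTop (𝓝 (f y)) := by
  have hf1 : MemLp f 1 ν := memLp_one_iff_integrable.2 hf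
  have key : ∀ k : ℕ, ∃ g : BoundedContinuousFunction Y G,
      eLpNorm (f - (g : Y → G)) 1 ν ≤ ((k : ℝ≥0∞) + 1)⁻¹ ∧ MemLp g 1 ν := fun k =>
    hf1.exists_boundedContinuous_eLpNorm_sub_le (by simp) (by simp)
  choose g hg hgm using key
  have hlim : Tendsto (fun k => eLpNorm ((g k : Y → G) - f) 1 ν) atTop (𝓝 0) := by
    have h0 : Tendsto (fun k : ℕ => ((k : ℝ≥0∞) + 1)⁻¹) atTop (𝓝 0) := by
      have := ENNReal.tendsto_inv_nat_nhds_zero.comp (tendsto_add_atTop_nat 1)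
      refine this.congr fun k => ?_
      simp
    refine tendsto_of_tendsto_of_tendsto_of_le_of_le tendsto_const_nhds h0
      (fun _ => zero_le) fun k => ?_
    rw [eLpNorm_sub_comm]
    exact hg k
  obtain ⟨ns, -, hns⟩ := (tendstoInMeasure_of_tendsto_eLpNorm one_ne_zero
    (fun k => (hgm k).1) hf1.1 hlim).exists_seq_tendsto_ae
  exact ⟨fun k => g (ns k), hns⟩

/-- The bounded continuous function obtained by truncating the values of `F` at height `R`. -/
noncomputable def clampBCF {R : ℝ} (hR : 0 ≤ R) (F : BoundedContinuousFunction Y ℝ) :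
    BoundedContinuousFunction Y ℝ :=
  BoundedContinuousFunction.ofNormedAddCommGroup (fun y => clamp R (F y))
    ((continuous_clamp R).comp F.continuous) R fun _ => abs_clamp_le hR _

theorem exists_boundedContinuous_abs_le_tendsto_ae {ν : Measure Y} [IsFiniteMeasure ν] {f : Y → ℝ}
    (hf : AEStronglyMeasurable f ν) {R : ℝ} (hR : ∀ y, |f y| ≤ R) (hR0 : 0 ≤ R) :
    ∃ F : ℕ → BoundedContinuousFunction Y ℝ, (∀ k y, |F k y| ≤ R) ∧
      ∀ᵐ y ∂ν, Tendsto (fun k => F k y) atTop (𝓝 (f y)) := by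
  obtain ⟨F, hF⟩ := exists_boundedContinuous_tendsto_ae
    (Integrable.of_bound hf R (Eventually.of_forall hR))
  refine ⟨fun k => clampBCF hR0 (F k), fun k y => abs_clamp_le hR0 _, ?_⟩
  filter_upwards [hF] with y hy
  have := ((continuous_clamp R).tendsto (f y)).comp hy
  rwa [clamp_of_abs_le (hR y)] at this

/-- The `L¹` norm is computed by testing against bounded continuous functions. -/
theorem integral_abs_le_of_forall_boundedContinuous {ν : Measure Y} [IsFiniteMeasure ν]
    {h : Y → ℝ} (hh : Integrable h ν) {c : ℝ}
    (hc : ∀ F : BoundedContinuousFunction Y ℝ, (∀ y, |F y| ≤ 1) → ∫ y, h y * F y ∂ν ≤ c) :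
    ∫ y, |h y| ∂ν ≤ c := by
  obtain ⟨F, hF1, hF⟩ := exists_boundedContinuous_abs_le_tendsto_ae (ν := ν)
    (f := fun y => SignType.sign (hh.1.mk h y))
    (R := 1)
    (by
      have : Measurable fun t : ℝ => ((SignType.sign t : SignType) : ℝ) := by
        have h1 : (fun t : ℝ => ((SignType.sign t : SignType) : ℝ)) =
            fun t => if 0 < t then 1 else if t < 0 then -1 else 0 := by
          funext t
          rcases lt_trichotomy t 0 with h | h | h
          · simp [h, h.not_gt]
          · simp [h]
          · simp [h]
        rw [h1]
        exact Measurable.ite measurableSet_Ioi measurable_const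
          (Measurable.ite measurableSet_Iio measurable_const measurable_const)
      exact (this.comp hh.1.stronglyMeasurable_mk.measurable).aestronglyMeasurable)
    (fun y => by
      rcases SignType.sign (hh.1.mk h y) with _ | _ | _ <;> simp)
    zero_le_one
  have hlim : Tendsto (fun k => ∫ y, h y * F k y ∂ν) atTop (𝓝 (∫ y, |h y| ∂ν)) := by
    refine tendsto_integral_of_dominated_convergence (fun y => |h y|)
      (fun k => hh.1.mul (F k).continuous.aestronglyMeasurable) hh.abs (fun k => ?_) ?_
    · refine Eventually.of_forall fun y => ?_
      rw [Real.norm_eq_abs, abs_mul]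
      exact mul_le_of_le_one_right (abs_nonneg _) (hF1 k y)
    · filter_upwards [hF, hh.1.ae_eq_mk] with y hy hy'
      have := hy.const_mul (h y)
      rwa [← hy', self_mul_sign] at this
  exact le_of_tendsto' hlim fun k => hc _ (hF1 k)

end Density

/-! ### Representation of functionals -/

section Riesz

variable {Y : Type*} [TopologicalSpace Y] [TopologicalSpace.PseudoMetrizableSpace Y]
  [MeasurableSpace Y] [BorelSpace Y] [SecondCountableTopology Y]

/-- A functional on bounded continuous functions that is bounded by the `L¹` norm is represented by
an integrable function; it extends to `L²`, so the Riesz representation theorem applies. -/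
theorem exists_integrable_repr {ν : Measure Y} [IsFiniteMeasure ν]
    (Λ : BoundedContinuousFunction Y ℝ →ₗ[ℝ] ℝ) {c : ℝ} (hc : 0 ≤ c)
    (hΛ : ∀ F, |Λ F| ≤ c * ∫ y, |F y| ∂ν) :
    ∃ h : Y → ℝ, Integrable h ν ∧ ∀ F, Λ F = ∫ y, h y * F y ∂ν := by
  set J := BoundedContinuousFunction.toLp (E := ℝ) 2 ν ℝ with hJ
  have hdense : DenseRange J := BoundedContinuousFunction.toLp_denseRange ℝ ν ℝ (by simp)
  have hJae : ∀ F, J F =ᵐ[ν] F := fun F => BoundedContinuousFunction.coeFn_toLp 2 ν ℝ F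
  have hint : ∀ F : BoundedContinuousFunction Y ℝ, Integrable F ν := fun F => F.integrable ν
  set one : Lp ℝ 2 ν := J (BoundedContinuousFunction.const Y 1) with hone
  have hnorm : ∃ C, ∀ F, ‖Λ F‖ ≤ C * ‖J.toLinearMap F‖ := by
    refine ⟨c * ‖one‖, fun F => (hΛ F).trans ?_⟩
    rw [mul_assoc]
    refine mul_le_mul_of_nonneg_left ?_ hc
    set Fa : BoundedContinuousFunction Y ℝ := BoundedContinuousFunction.ofNormedAddCommGroup
      (fun y => |F y|) F.continuous.abs ‖F‖ (fun y => by
        rw [norm_abs_eq_norm]; exact F.norm_coe_le_norm y) with hFa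
    have h1 : ∫ y, |F y| ∂ν = inner ℝ one (J Fa) := by
      rw [L2.inner_def]
      refine integral_congr_ae ?_
      filter_upwards [hJae (BoundedContinuousFunction.const Y 1), hJae Fa] with y h1 h2
      rw [h1, h2]
      simp [hFa]
    have h2 : ‖J Fa‖ = ‖J F‖ := by
      refine le_antisymm (Lp.norm_le_norm_of_ae_le ?_) (Lp.norm_le_norm_of_ae_le ?_) <;>
      · filter_upwards [hJae Fa, hJae F] with y h1 h2
        rw [h1, h2]
        simp [hFa]
    rw [h1]
    refine (real_inner_le_norm _ _).trans ?_
    rw [h2]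
    rfl
  set h := (InnerProductSpace.toDual ℝ (Lp ℝ 2 ν)).symm (Λ.extendOfNorm J.toLinearMap) with hh
  refine ⟨h, (Lp.memLp h).integrable (by norm_num), fun F => ?_⟩
  have h1 : Λ F = inner ℝ h (J F) := by
    rw [hh, InnerProductSpace.toDual_symm_apply]
    exact (LinearMap.extendOfNorm_eq hdense hnorm F).symm
  rw [h1, L2.inner_def]
  refine integral_congr_ae ?_
  filter_upwards [hJae F] with y hy
  rw [hy]
  simp [mul_comm]

end Riesz

/-! ### Integral bounds in terms of modulars -/

section ModularIntegral

variable {B : ℝ → ℝ}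

theorem IsNFunction.aestronglyMeasurable_modular (hB : IsNFunction B) {α : Type*}
    [MeasurableSpace α] {μ : Measure α} {u : α → ℝ} (hu : AEStronglyMeasurable u μ) {K : ℝ}
    (hK : 0 < K) : AEStronglyMeasurable (fun x => B (|u x| / K)) μ := by
  have := hB.continuous_abs.comp_aestronglyMeasurable
    (hu.aemeasurable.div_const K).aestronglyMeasurable
  simpa only [Function.comp_def, abs_div, abs_of_pos hK] using this

theorem IsNFunction.integrable_modular (hB : IsNFunction B) {α : Type*} [MeasurableSpace α]
    {μ : Measure α} {u : α → ℝ} (hu : AEStronglyMeasurable u μ) {K : ℝ} (hK : 0 < K)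
    (h : ∫⁻ x, ENNReal.ofReal (B (|u x| / K)) ∂μ ≤ 1) :
    Integrable (fun x => B (|u x| / K)) μ ∧ ∫ x, B (|u x| / K) ∂μ ≤ 1 := by
  have h0 : ∀ x, 0 ≤ B (|u x| / K) := fun x => hB.nonneg (by positivity)
  have hm := hB.aestronglyMeasurable_modular hu hK
  refine ⟨⟨hm, ?_⟩, ?_⟩
  · rw [hasFiniteIntegral_iff_ofReal (Eventually.of_forall h0)]
    exact h.trans_lt ENNReal.one_lt_top
  · rw [integral_eq_lintegral_of_nonneg_ae (Eventually.of_forall h0) hm]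
    exact ENNReal.toReal_le_of_le_ofReal zero_le_one (by simpa using h)

/-- The integral form of Young's inequality, with a scaling parameter `c`. -/
theorem IsNFunction.integral_mul_le (hB : IsNFunction B) {α : Type*} [MeasurableSpace α]
    {μ : Measure α} {u w : α → ℝ} {K c : ℝ} (hK : 0 < K) (hc : 0 < c)
    (hu : AEStronglyMeasurable u μ) (hw : AEStronglyMeasurable w μ) (hw0 : ∀ x, 0 ≤ w x)
    (huB : Integrable (fun x => B (|u x| / K)) μ) (hwB : Integrable (fun x => conj B (c * w x)) μ) :
    Integrable (fun x => |u x| * w x) μ ∧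
      ∫ x, |u x| * w x ∂μ ≤ K / c * (∫ x, B (|u x| / K) ∂μ + ∫ x, conj B (c * w x) ∂μ) := by
  have hpt : ∀ x, |u x| * w x ≤ K / c * (B (|u x| / K) + conj B (c * w x)) := fun x => by
    have h := hB.young (s := |u x| / K) (by positivity) (c * w x)
    have h2 : |u x| * w x = K / c * (|u x| / K * (c * w x)) := by field_simp
    rw [h2]
    exact mul_le_mul_of_nonneg_left h (by positivity)
  have hi : Integrable (fun x => K / c * (B (|u x| / K) + conj B (c * w x))) μ :=
    (huB.add hwB).const_mul _
  have hint : Integrable (fun x => |u x| * w x) μ := by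
    refine hi.mono' (hu.norm.mul hw) (Eventually.of_forall fun x => ?_)
    rw [Real.norm_of_nonneg (mul_nonneg (abs_nonneg _) (hw0 x))]
    exact hpt x
  refine ⟨hint, (integral_mono hint hi hpt).trans_eq ?_⟩
  rw [integral_const_mul, integral_add huB hwB]

theorem IsNFunction.integrable_of_modular (hB : IsNFunction B) {α : Type*} [MeasurableSpace α]
    {μ : Measure α} [IsFiniteMeasure μ] {u : α → ℝ} {K : ℝ} (hK : 0 < K)
    (hu : AEStronglyMeasurable u μ) (huB : Integrable (fun x => B (|u x| / K)) μ) :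
    Integrable u μ := by
  have := (hB.integral_mul_le (w := fun _ => 1) hK one_pos hu aestronglyMeasurable_const
    (fun _ => zero_le_one) huB (integrable_const _)).1
  simp only [mul_one] at this
  exact (integrable_norm_iff hu).1 this

theorem IsNFunction.integrable_of_conj_modular (hB : IsNFunction B) {α : Type*} [MeasurableSpace α]
    {μ : Measure α} [IsFiniteMeasure μ] {w : α → ℝ} (hw : AEStronglyMeasurable w μ)
    (hw0 : ∀ x, 0 ≤ w x) (hwB : Integrable (fun x => conj B (1 * w x)) μ) : Integrable w μ := by
  have := (hB.integral_mul_le (u := fun _ => 1) one_pos one_pos aestronglyMeasurable_const hw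
    hw0 (integrable_const _) hwB).1
  simpa using this

theorem exists_boundedContinuous_comp {Y : Type*} [TopologicalSpace Y] {Φ : ℝ → ℝ} (hΦ : Continuous Φ)
    (F : BoundedContinuousFunction Y ℝ) :
    ∃ G : BoundedContinuousFunction Y ℝ, ∀ y, G y = Φ (F y) := by
  obtain ⟨C, hC⟩ := (isCompact_Icc (a := -‖F‖) (b := ‖F‖)).exists_bound_of_continuousOn
    hΦ.continuousOn
  exact ⟨BoundedContinuousFunction.ofNormedAddCommGroup (fun y => Φ (F y))
    (hΦ.comp F.continuous) C fun y => hC _ (abs_le.1 (F.norm_coe_le_norm y)), fun _ => rfl⟩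

variable {Y : Type*} [TopologicalSpace Y] [TopologicalSpace.PseudoMetrizableSpace Y]
  [MeasurableSpace Y] [BorelSpace Y] [SecondCountableTopology Y]

/-- A modular bound by duality: testing with a truncation of `b ∘ g`, where `b` realizes equality in
Young's inequality, recovers the modular of `g` on the sets `{|g| ≤ m}`. -/
theorem IsNFunction.lintegral_le_one_of_forall_boundedContinuous (hB : IsNFunction B)
    {ν : Measure Y} [IsFiniteMeasure ν] {g : Y → ℝ} (hg : Integrable g ν) (hgm : Measurable g)
    (h : ∀ F : BoundedContinuousFunction Y ℝ,
      ∫ y, g y * F y ∂ν ≤ 1 + ∫ y, conj B |F y| ∂ν) :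
    ∫⁻ y, ENNReal.ofReal (B |g y|) ∂ν ≤ 1 := by
  obtain ⟨b, hbm, hb1, hb2⟩ := hB.exists_young_eq
  have hcont : Continuous fun t => conj B |t| := hB.continuous_conj.comp _root_.continuous_abs
  have hbdd : ∀ (R : ℝ) (f : Y → ℝ), AEStronglyMeasurable f ν → (∀ y, |f y| ≤ R) → 0 ≤ R →
      ∫ y, g y * f y ∂ν ≤ 1 + ∫ y, conj B |f y| ∂ν := by
    intro R f hf hR hR0
    obtain ⟨F, hFR, hF⟩ := exists_boundedContinuous_abs_le_tendsto_ae hf hR hR0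
    have h1 : Tendsto (fun k => ∫ y, g y * F k y ∂ν) atTop (𝓝 (∫ y, g y * f y ∂ν)) := by
      refine tendsto_integral_of_dominated_convergence (fun y => |g y| * R)
        (fun k => hg.1.mul (F k).continuous.aestronglyMeasurable) (hg.abs.mul_const R)
        (fun k => ?_) ?_
      · refine Eventually.of_forall fun y => ?_
        rw [Real.norm_eq_abs, abs_mul]
        exact mul_le_mul_of_nonneg_left (hFR k y) (abs_nonneg _)
      · filter_upwards [hF] with y hy
        exact hy.const_mul (g y)
    have h2 : Tendsto (fun k => ∫ y, conj B |F k y| ∂ν) atTop (𝓝 (∫ y, conj B |f y| ∂ν)) := by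
      refine tendsto_integral_of_dominated_convergence (fun _ => conj B R)
        (fun k => (hcont.comp (F k).continuous).aestronglyMeasurable) (integrable_const _)
        (fun k => ?_) ?_
      · refine Eventually.of_forall fun y => ?_
        rw [Real.norm_of_nonneg (hB.conj_nonneg _)]
        exact hB.conj_mono (hFR k y)
      · filter_upwards [hF] with y hy
        exact (hcont.tendsto _).comp hy
    exact le_of_tendsto_of_tendsto' h1 (h2.const_add 1) fun k => h (F k)
  set s : ℕ → Set Y := fun m => {y | |g y| ≤ m} with hs
  have hsm : ∀ m, MeasurableSet (s m) := fun m => measurableSet_le hgm.abs measurable_const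
  have hpart : ∀ m : ℕ, ∫⁻ y, (s m).indicator (fun y => ENNReal.ofReal (B |g y|)) y ∂ν ≤ 1 := by
    intro m
    set f : Y → ℝ := (s m).indicator fun y => b (g y) with hf
    have hfm : Measurable f := (hbm.comp hgm).indicator (hsm m)
    have hfR : ∀ y, |f y| ≤ B (m + 1) := fun y => by
      by_cases hy : y ∈ s m
      · rw [hf, indicator_of_mem hy]
        exact hb2 _ _ hy
      · rw [hf, indicator_of_notMem hy, abs_zero]
        exact hB.nonneg (by positivity)
    have hle := hbdd _ f hfm.aestronglyMeasurable hfR (hB.nonneg (by positivity))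
    have hpt : ∀ y, (s m).indicator (fun y => B |g y|) y ≤ g y * f y - conj B |f y| := fun y => by
      by_cases hy : y ∈ s m
      · rw [hf, indicator_of_mem hy, indicator_of_mem hy]
        have := hb1 (g y)
        linarith
      · rw [hf, indicator_of_notMem hy, indicator_of_notMem hy]
        simp [hB.conj_zero]
    have hi1 : Integrable (fun y => g y * f y) ν :=
      hg.mul_bdd hfm.aestronglyMeasurable (Eventually.of_forall hfR)
    have hi2 : Integrable (fun y => conj B |f y|) ν := by
      refine Integrable.of_bound (hcont.measurable.comp hfm).aestronglyMeasurable
        (conj B (B (m + 1))) (Eventually.of_forall fun y => ?_)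
      rw [Real.norm_of_nonneg (hB.conj_nonneg _)]
      exact hB.conj_mono (hfR y)
    have hnn : ∀ y, 0 ≤ (s m).indicator (fun y => B |g y|) y := fun y =>
      indicator_nonneg (fun y _ => hB.nonneg (abs_nonneg _)) y
    have hi3 : Integrable ((s m).indicator fun y => B |g y|) ν := by
      refine (hi1.sub hi2).mono'
        ((hB.continuous_abs.measurable.comp hgm).indicator (hsm m)).aestronglyMeasurable
        (Eventually.of_forall fun y => ?_)
      rw [Real.norm_of_nonneg (hnn y)]
      exact hpt y
    have h3 : ∫ y, (s m).indicator (fun y => B |g y|) y ∂ν ≤ 1 := by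
      refine (integral_mono hi3 (hi1.sub hi2) hpt).trans ?_
      simp only [Pi.sub_apply]
      rw [integral_sub hi1 hi2]
      linarith
    have h4 : ∀ y, (s m).indicator (fun y => ENNReal.ofReal (B |g y|)) y =
        ENNReal.ofReal ((s m).indicator (fun y => B |g y|) y) := fun y => by
      by_cases hy : y ∈ s m <;> simp [hy]
    simp_rw [h4]
    rw [← ofReal_integral_eq_lintegral_ofReal hi3 (Eventually.of_forall hnn)]
    exact ENNReal.ofReal_le_one.2 h3
  refine le_of_tendsto' (lintegral_tendsto_of_tendsto_of_monotone
    (f := fun m => (s m).indicator fun y => ENNReal.ofReal (B |g y|)) (fun m => ?_) ?_ ?_) hpart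
  · exact ((hB.continuous_abs.measurable.comp hgm).ennreal_ofReal.indicator (hsm m)).aemeasurable
  · refine Eventually.of_forall fun y m m' hm => ?_
    exact indicator_le_indicator_of_subset (fun y (hy : |g y| ≤ m) =>
      show |g y| ≤ m' from hy.trans (by exact_mod_cast hm)) (fun _ => zero_le) y
  · refine Eventually.of_forall fun y => tendsto_const_nhds.congr' ?_
    filter_upwards [eventually_ge_atTop ⌈|g y|⌉₊] with m hm
    rw [indicator_of_mem]
    exact Nat.ceil_le.1 hm

theorem exists_integrable_tendsto_of_cauchy {α : Type*} [MeasurableSpace α] {ν : Measure α}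
    {h : ℕ → α → ℝ} (hh : ∀ m, Integrable (h m) ν)
    (hc : ∀ η > 0, ∃ M, ∀ m ≥ M, ∀ m' ≥ M, ∫ y, |h m y - h m' y| ∂ν ≤ η) :
    ∃ g : α → ℝ, Integrable g ν ∧ Tendsto (fun m => ∫ y, |g y - h m y| ∂ν) atTop (𝓝 0) := by
  have hdist : ∀ {f g : α → ℝ} (hf : Integrable f ν) (hg : Integrable g ν),
      dist (hf.toL1 f) (hg.toL1 g) = ∫ y, |f y - g y| ∂ν := fun hf hg => by
    rw [dist_eq_norm, ← Integrable.toL1_sub, L1.norm_of_fun_eq_integral_norm]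
    rfl
  have hcau : CauchySeq fun m => (hh m).toL1 (h m) := by
    refine Metric.cauchySeq_iff.2 fun r hr => ?_
    obtain ⟨M, hM⟩ := hc (r / 2) (half_pos hr)
    refine ⟨M, fun m hm m' hm' => ?_⟩
    rw [hdist]
    exact (hM m hm m' hm').trans_lt (half_lt_self hr)
  obtain ⟨G, hG⟩ := cauchySeq_tendsto_of_complete hcau
  have hGi := L1.integrable_coeFn G
  refine ⟨G, hGi, ?_⟩
  have := hG.dist (tendsto_const_nhds (x := G))
  rw [dist_self] at this
  refine this.congr fun m => ?_
  conv_lhs => rw [← Integrable.toL1_coeFn G hGi, hdist]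
  simp_rw [abs_sub_comm]

end ModularIntegral

/-! ### Functions with values in `C(S, ℝ)` and their traces -/

section Trace

variable {S : Type*} [TopologicalSpace S]

/-- Post-composition with the truncation at height `R`. -/
noncomputable def clampC (R : ℝ) (w : C(S, ℝ)) : C(S, ℝ) :=
  (⟨clamp R, continuous_clamp R⟩ : C(ℝ, ℝ)).comp w

theorem continuous_clampC (R : ℝ) : Continuous (clampC R : C(S, ℝ) → C(S, ℝ)) :=
  ContinuousMap.continuous_postcomp _

variable [CompactSpace S]

theorem norm_clampC_le {R : ℝ} (hR : 0 ≤ R) (w : C(S, ℝ)) : ‖clampC R w‖ ≤ R :=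
  (ContinuousMap.norm_le _ hR).2 fun _ => abs_clamp_le hR _

theorem clampC_of_norm_le {R : ℝ} {w : C(S, ℝ)} (h : ‖w‖ ≤ R) : clampC R w = w :=
  ContinuousMap.ext fun s => clamp_of_abs_le ((w.norm_coe_le_norm s).trans h)

theorem norm_sub_clampC_le {R : ℝ} (hR : 0 ≤ R) (w : C(S, ℝ)) : ‖w - clampC R w‖ ≤ ‖w‖ :=
  (ContinuousMap.norm_le _ (norm_nonneg _)).2 fun s =>
    (abs_sub_clamp_le hR (w s)).trans (w.norm_coe_le_norm s)

variable {X : Type*} [MeasurableSpace X] {μ : Measure X}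

theorem integrable_curry [TopologicalSpace X] [OpensMeasurableSpace X]
    [SecondCountableTopology X]
    [TopologicalSpace.PseudoMetrizableSpace X] [IsFiniteMeasure μ]
    (F : BoundedContinuousFunction (X × S) ℝ) :
    Integrable (fun x => F.toContinuousMap.curry x) μ :=
  Integrable.of_bound F.toContinuousMap.curry.continuous.aestronglyMeasurable ‖F‖
    (Eventually.of_forall fun x => (ContinuousMap.norm_le _ (norm_nonneg _)).2 fun s =>
      F.norm_coe_le_norm (x, s))

section ModularDensity

variable [TopologicalSpace X] [TopologicalSpace.PseudoMetrizableSpace X] [BorelSpace X]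
  [SecondCountableTopology X] {B : ℝ → ℝ}

/-- Bounded continuous functions on `X × S` are dense, in the sense of modulars, among the functions
`f : X → C(S, ℝ)` all of whose multiples have finite modular. -/
theorem IsNFunction.exists_boundedContinuous_conj_le (hB : IsNFunction B) [IsFiniteMeasure μ]
    {f : X → C(S, ℝ)} (hf : AEStronglyMeasurable f μ)
    (hfB : ∀ c : ℝ, 0 < c → Integrable (fun x => conj B (c * ‖f x‖)) μ) {c : ℝ} (hc : 0 < c) :
    ∃ F : BoundedContinuousFunction (X × S) ℝ,
      Integrable (fun x => conj B (c * ‖f x - F.toContinuousMap.curry x‖)) μ ∧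
      ∫ x, conj B (c * ‖f x - F.toContinuousMap.curry x‖) ∂μ ≤ 1 := by
  have hcont := hB.continuous_conj
  have hd : 0 < 2 * c := by positivity
  have hmeas : ∀ {g h : X → C(S, ℝ)}, AEStronglyMeasurable g μ → AEStronglyMeasurable h μ →
      ∀ d, AEStronglyMeasurable (fun x => conj B (d * ‖g x - h x‖)) μ := fun hg hh d =>
    hcont.comp_aestronglyMeasurable ((hg.sub hh).norm.const_mul d)
  have hclamp : ∀ R, AEStronglyMeasurable (fun x => clampC R (f x)) μ := fun R =>
    (continuous_clampC R).comp_aestronglyMeasurable hf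
  have hle : ∀ (R : ℕ) x, conj B (2 * c * ‖f x - clampC R (f x)‖) ≤ conj B (2 * c * ‖f x‖) :=
    fun R x => hB.conj_mono
      (mul_le_mul_of_nonneg_left (norm_sub_clampC_le R.cast_nonneg _) hd.le)
  -- Truncate `f` at a large height, then approximate the truncation almost everywhere.
  have hlim1 : Tendsto (fun R : ℕ => ∫ x, conj B (2 * c * ‖f x - clampC R (f x)‖) ∂μ) atTop
      (𝓝 (∫ _, 0 ∂μ)) := by
    refine tendsto_integral_of_dominated_convergence _ (fun R => hmeas hf (hclamp R) _)
      (hfB _ hd) (fun R => Eventually.of_forall fun x => ?_) (Eventually.of_forall fun x => ?_)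
    · rw [Real.norm_of_nonneg (hB.conj_nonneg _)]
      exact hle R x
    · refine tendsto_const_nhds.congr' ?_
      filter_upwards [eventually_ge_atTop ⌈‖f x‖⌉₊] with R hR
      rw [clampC_of_norm_le (Nat.ceil_le.1 hR), sub_self, norm_zero, mul_zero, hB.conj_zero]
  rw [integral_zero] at hlim1
  obtain ⟨R, hR⟩ := (hlim1.eventually_le_const zero_lt_one).exists
  have hR0 : (0 : ℝ) ≤ R := R.cast_nonneg
  have hi1 : Integrable (fun x => conj B (2 * c * ‖f x - clampC R (f x)‖)) μ :=
    (hfB _ hd).mono' (hmeas hf (hclamp R) _) (Eventually.of_forall fun x => by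
      rw [Real.norm_of_nonneg (hB.conj_nonneg _)]
      exact hle R x)
  obtain ⟨G, hG⟩ := exists_boundedContinuous_tendsto_ae (Integrable.of_bound (hclamp R) R
    (Eventually.of_forall fun x => norm_clampC_le hR0 (f x)))
  have hGm : ∀ k, AEStronglyMeasurable (fun x => clampC R (G k x)) μ := fun k =>
    ((continuous_clampC R).comp (G k).continuous).aestronglyMeasurable
  have hle2 : ∀ k x, ‖conj B (2 * c * ‖clampC R (f x) - clampC R (G k x)‖)‖ ≤
      conj B (2 * c * (R + R)) := fun k x => by
    rw [Real.norm_of_nonneg (hB.conj_nonneg _)]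
    refine hB.conj_mono (mul_le_mul_of_nonneg_left ((norm_sub_le _ _).trans ?_) hd.le)
    exact add_le_add (norm_clampC_le hR0 _) (norm_clampC_le hR0 _)
  have hlim2 : Tendsto (fun k => ∫ x, conj B (2 * c * ‖clampC R (f x) - clampC R (G k x)‖) ∂μ)
      atTop (𝓝 (∫ _, 0 ∂μ)) := by
    refine tendsto_integral_of_dominated_convergence _ (fun k => hmeas (hclamp R) (hGm k) _)
      (integrable_const (conj B (2 * c * (R + R)))) (fun k => Eventually.of_forall (hle2 k)) ?_
    filter_upwards [hG] with x hx
    have h1 := ((continuous_clampC R).tendsto _).comp hx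
    rw [clampC_of_norm_le (norm_clampC_le hR0 (f x))] at h1
    have h2 := (tendsto_const_nhds.sub h1 : Tendsto (fun k => clampC R (f x) - clampC R (G k x))
      atTop (𝓝 (clampC R (f x) - clampC R (f x)))).norm.const_mul (2 * c)
    have h3 := (hcont.tendsto _).comp h2
    simpa [hB.conj_zero, Function.comp_def] using h3
  rw [integral_zero] at hlim2
  obtain ⟨k, hk⟩ := (hlim2.eventually_le_const zero_lt_one).exists
  have hi2 : Integrable (fun x => conj B (2 * c * ‖clampC R (f x) - clampC R (G k x)‖)) μ :=
    Integrable.of_bound (hmeas (hclamp R) (hGm k) _) _ (Eventually.of_forall (hle2 k))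
  set F : BoundedContinuousFunction (X × S) ℝ := BoundedContinuousFunction.ofNormedAddCommGroup
    (fun p => clampC R (G k p.1) p.2)
    ((show Continuous fun q : C(S, ℝ) × S => q.1 q.2 by fun_prop).comp
      ((((continuous_clampC R).comp (G k).continuous).comp continuous_fst).prodMk continuous_snd))
    R (fun p => abs_clamp_le hR0 _) with hF
  have hFc : ∀ x, F.toContinuousMap.curry x = clampC R (G k x) := fun x => rfl
  have hpt : ∀ x, conj B (c * ‖f x - F.toContinuousMap.curry x‖) ≤
      1 / 2 * (conj B (2 * c * ‖f x - clampC R (f x)‖) +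
        conj B (2 * c * ‖clampC R (f x) - clampC R (G k x)‖)) := fun x => by
    have h1 : c * ‖f x - F.toContinuousMap.curry x‖ ≤
        (1 / 2 : ℝ) • (2 * c * ‖f x - clampC R (f x)‖) +
          (1 / 2 : ℝ) • (2 * c * ‖clampC R (f x) - clampC R (G k x)‖) := by
      rw [hFc]
      have := mul_le_mul_of_nonneg_left
        (norm_sub_le_norm_sub_add_norm_sub (f x) (clampC R (f x)) (clampC R (G k x))) hc.le
      simp only [smul_eq_mul]
      linarith
    refine (hB.conj_mono h1).trans ((hB.convexOn_conj.2 (mem_univ _) (mem_univ _) ?_ ?_ ?_).trans ?_)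
    any_goals norm_num
    rw [mul_add]
  have hsum := (hi1.add hi2).const_mul (1 / 2 : ℝ)
  have hFi : Integrable (fun x => conj B (c * ‖f x - F.toContinuousMap.curry x‖)) μ :=
    hsum.mono' (hmeas hf F.toContinuousMap.curry.continuous.aestronglyMeasurable _)
      (Eventually.of_forall fun x => by
        rw [Real.norm_of_nonneg (hB.conj_nonneg _)]
        exact hpt x)
  refine ⟨F, hFi, (integral_mono hFi hsum hpt).trans ?_⟩
  simp only [Pi.add_apply]
  rw [integral_const_mul, integral_add hi1 hi2]
  linarith

end ModularDensity

variable [TopologicalSpace.PseudoMetrizableSpace S] [MeasurableSpace S] [BorelSpace S]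
  [SecondCountableTopology S] {σ : Measure S}

theorem aestronglyMeasurable_eval [SFinite σ] {f : X → C(S, ℝ)} (hf : AEStronglyMeasurable f μ) :
    AEStronglyMeasurable (fun p : X × S => f p.1 p.2) (μ.prod σ) :=
  (show Continuous fun q : C(S, ℝ) × S => q.1 q.2 by fun_prop).comp_aestronglyMeasurable
    (hf.comp_fst.prodMk measurable_snd.aestronglyMeasurable)

theorem aestronglyMeasurable_trace {f : X → C(S, ℝ)} (hf : AEStronglyMeasurable f μ) {τ : X → S}
    (hτ : Measurable τ) : AEStronglyMeasurable (fun x => f x (τ x)) μ :=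
  (show Continuous fun q : C(S, ℝ) × S => q.1 q.2 by fun_prop).comp_aestronglyMeasurable
    (hf.prodMk hτ.aestronglyMeasurable)

theorem integrable_eval [IsFiniteMeasure σ] {f : X → C(S, ℝ)} (hf : Integrable f μ) :
    Integrable (fun p : X × S => f p.1 p.2) (μ.prod σ) :=
  (hf.comp_fst σ).norm.mono' (aestronglyMeasurable_eval hf.1)
    (Eventually.of_forall fun p => (f p.1).norm_coe_le_norm p.2)

theorem integrable_trace {f : X → C(S, ℝ)} (hf : Integrable f μ) {τ : X → S}
    (hτ : Measurable τ) : Integrable (fun x => f x (τ x)) μ :=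
  hf.norm.mono' (aestronglyMeasurable_trace hf.1 hτ)
    (Eventually.of_forall fun x => (f x).norm_coe_le_norm (τ x))

theorem abs_integral_mul_trace_sub_le {f g : X → C(S, ℝ)} (hf : Integrable f μ)
    (hg : Integrable g μ) {τ : X → S} (hτ : Measurable τ) {a : X → ℝ}
    (ha : AEStronglyMeasurable a μ) {R : ℝ} (hR : ∀ x, |a x| ≤ R) :
    |∫ x, a x * f x (τ x) ∂μ - ∫ x, a x * g x (τ x) ∂μ| ≤ R * ∫ x, ‖f x - g x‖ ∂μ := by
  have h1 : Integrable (fun x => a x * f x (τ x)) μ :=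
    (integrable_trace hf hτ).bdd_mul ha (Eventually.of_forall hR)
  have h2 : Integrable (fun x => a x * g x (τ x)) μ :=
    (integrable_trace hg hτ).bdd_mul ha (Eventually.of_forall hR)
  rw [← integral_sub h1 h2, ← integral_const_mul]
  rw [← Real.norm_eq_abs]
  refine norm_integral_le_of_norm_le ((hf.sub hg).norm.const_mul R) (Eventually.of_forall fun x => ?_)
  rw [← mul_sub, norm_mul]
  exact mul_le_mul (hR x) ((f x - g x).norm_coe_le_norm (τ x)) (norm_nonneg _)
    ((abs_nonneg _).trans (hR x))

/-- If the maps `τ n` mix, i.e. products `φ ⊗ w` satisfy the mean value property, then the mean value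
property holds for all Bochner integrable functions with values in `C(S, ℝ)`. -/
theorem tendsto_integral_trace [IsFiniteMeasure μ] [IsProbabilityMeasure σ] {τ : ℕ → X → S}
    (hτ : ∀ n, Measurable (τ n))
    (hmix : ∀ φ : X → ℝ, Integrable φ μ → ∀ w : C(S, ℝ), Tendsto
      (fun n => ∫ x, φ x * w (τ n x) ∂μ) atTop (𝓝 ((∫ x, φ x ∂μ) * ∫ s, w s ∂σ)))
    {f : X → C(S, ℝ)} (hf : Integrable f μ) :
    Tendsto (fun n => ∫ x, f x (τ n x) ∂μ) atTop (𝓝 (∫ p, f p.1 p.2 ∂(μ.prod σ))) := by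
  refine Integrable.induction (P := fun f : X → C(S, ℝ) => Tendsto (fun n => ∫ x, f x (τ n x) ∂μ)
    atTop (𝓝 (∫ p, f p.1 p.2 ∂(μ.prod σ)))) ?_ ?_ ?_ ?_ hf
  · intro c s hs _
    have h1 : ∀ x t, (s.indicator (fun _ => c) x : C(S, ℝ)) t =
        s.indicator (fun _ => (1 : ℝ)) x * c t := fun x t => by
      by_cases hx : x ∈ s <;> simp [hx]
    simp only [h1]
    rw [integral_prod_mul (s.indicator fun _ => (1 : ℝ)) c]
    exact hmix _ ((integrable_const _).indicator hs) c
  · intro f g _ hf hg hPf hPg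
    simp only [Pi.add_apply, ContinuousMap.add_apply]
    rw [integral_add (integrable_eval hf) (integrable_eval hg)]
    refine (hPf.add hPg).congr fun n => ?_
    rw [integral_add (integrable_trace hf (hτ n)) (integrable_trace hg (hτ n))]
  · refine isClosed_of_closure_subset fun f hf => tendsto_of_forall_approx fun η hη => ?_
    obtain ⟨g, hg, hfg⟩ := Metric.mem_closure_iff.1 hf η hη
    have hd : ∫ x, ‖f x - g x‖ ∂μ ≤ η := by
      rw [dist_eq_norm, L1.norm_eq_integral_norm] at hfg
      refine (integral_congr_ae ?_).trans_le hfg.le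
      filter_upwards [Lp.coeFn_sub f g] with x hx
      rw [hx, Pi.sub_apply]
    have hfi := L1.integrable_coeFn f
    have hgi := L1.integrable_coeFn g
    refine ⟨_, _, hg, fun n => ?_, ?_⟩
    · have := abs_integral_mul_trace_sub_le hfi hgi (hτ n) (a := fun _ => 1)
        aestronglyMeasurable_const (R := 1) (by simp)
      simp only [one_mul] at this
      exact this.trans hd
    · rw [← integral_sub (integrable_eval hfi) (integrable_eval hgi)]
      refine (norm_integral_le_of_norm_le ((hfi.sub hgi).comp_fst σ).norm
        (Eventually.of_forall fun p => (f p.1 - g p.1).norm_coe_le_norm p.2)).trans ?_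
      rw [integral_fun_fst (fun x => ‖(f - g : X → C(S, ℝ)) x‖)]
      simpa using hd
  · intro f g hfg _ hPf
    have h2 : ∀ᵐ p ∂(μ.prod σ), f p.1 = g p.1 :=
      Measure.quasiMeasurePreserving_fst.ae hfg
    have h3 : ∫ p, g p.1 p.2 ∂(μ.prod σ) = ∫ p, f p.1 p.2 ∂(μ.prod σ) :=
      integral_congr_ae (h2.mono fun p hp => by simp only [hp])
    rw [h3]
    refine hPf.congr fun n => integral_congr_ae ?_
    filter_upwards [hfg] with x hx
    rw [hx]

end Trace

/-! ### Weak compactness along mixing maps -/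

section Compactness

variable {X : Type*} [MeasurableSpace X] {S : Type*} [TopologicalSpace S] [MeasurableSpace S]
  {μ : Measure X} {σ : Measure S} {B : ℝ → ℝ}

/-- The sequence of maps `τ n : X → S` mixes: for products `φ ⊗ w` the integrals of the traces
`x ↦ φ x * w (τ n x)` tend to the integral over `X × S`. -/
structure Mixing (μ : Measure X) (σ : Measure S) (τ : ℕ → X → S) : Prop where
  measurable : ∀ n, Measurable (τ n)
  tendsto : ∀ φ : X → ℝ, Integrable φ μ → ∀ w : C(S, ℝ), Tendsto
    (fun n => ∫ x, φ x * w (τ n x) ∂μ) atTop (𝓝 ((∫ x, φ x ∂μ) * ∫ s, w s ∂σ))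

theorem Mixing.comp {τ : ℕ → X → S} (hτ : Mixing μ σ τ) {φ : ℕ → ℕ} (hφ : StrictMono φ) :
    Mixing μ σ (τ ∘ φ) :=
  ⟨fun n => hτ.measurable (φ n), fun f hf w => (hτ.tendsto f hf w).comp hφ.tendsto_atTop⟩

/-- The superlinearity of `B` makes sequences with bounded modular uniformly integrable. -/
theorem IsNFunction.exists_forall_integral_sub_clamp_le (hB : IsNFunction B) [IsFiniteMeasure μ]
    {K : ℝ} (hK : 0 < K) {u : ℕ → X → ℝ} (hu : ∀ n, AEStronglyMeasurable (u n) μ)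
    (huB : ∀ n, Integrable (fun x => B (|u n x| / K)) μ)
    (huB1 : ∀ n, ∫ x, B (|u n x| / K) ∂μ ≤ 1) {η : ℝ} (hη : 0 < η) :
    ∃ M : ℕ, ∀ m : ℕ, M ≤ m → ∀ n, ∫ x, |u n x - clamp m (u n x)| ∂μ ≤ η := by
  obtain ⟨M₀, hM₀, hM⟩ := hB.exists_le_mul (δ := η / K) (by positivity)
  refine ⟨⌈K * M₀⌉₊, fun m hm n => ?_⟩
  have hpt : ∀ x, |u n x - clamp m (u n x)| ≤ η * B (|u n x| / K) := fun x => by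
    have hB0 : 0 ≤ B (|u n x| / K) := hB.nonneg (by positivity)
    rcases le_total |u n x| m with h | h
    · rw [clamp_of_abs_le h, sub_self, abs_zero]
      positivity
    · refine (abs_sub_clamp_le m.cast_nonneg _).trans ?_
      have h1 : M₀ ≤ |u n x| / K := by
        rw [le_div_iff₀ hK, mul_comm]
        exact (Nat.ceil_le.1 hm).trans h
      have h2 := hM _ h1
      rw [div_le_iff₀ hK] at h2
      refine h2.trans_eq ?_
      field_simp
  have hi : Integrable (fun x => |u n x - clamp m (u n x)|) μ :=
    ((huB n).const_mul η).mono'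
      ((hu n).sub ((continuous_clamp _).comp_aestronglyMeasurable (hu n))).norm
      (Eventually.of_forall fun x => by rw [Real.norm_eq_abs, abs_abs]; exact hpt x)
  refine (integral_mono hi ((huB n).const_mul η) hpt).trans ?_
  rw [integral_const_mul]
  exact mul_le_of_le_one_right hη.le (huB1 n)

variable [TopologicalSpace X] [TopologicalSpace.PseudoMetrizableSpace X] [BorelSpace X]
  [SecondCountableTopology X] [CompactSpace S] [TopologicalSpace.PseudoMetrizableSpace S]
  [BorelSpace S] [SecondCountableTopology S]

theorem Mixing.tendsto_boundedContinuous [IsFiniteMeasure μ] [IsProbabilityMeasure σ]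
    {τ : ℕ → X → S} (hτ : Mixing μ σ τ) (F : BoundedContinuousFunction (X × S) ℝ) :
    Tendsto (fun n => ∫ x, F (x, τ n x) ∂μ) atTop (𝓝 (∫ p, F p ∂(μ.prod σ))) :=
  tendsto_integral_trace hτ.measurable hτ.tendsto (integrable_curry F)

/-- Along a subsequence, the integrals of all truncations `clamp m (u n)` against traces of bounded
continuous functions converge; separability of `L¹(μ; C(S, ℝ))` makes the extraction possible. -/
theorem exists_subseq_tendsto_clamp [IsFiniteMeasure μ] {τ : ℕ → X → S}
    (hτ : ∀ n, Measurable (τ n)) {u : ℕ → X → ℝ} (hu : ∀ n, AEStronglyMeasurable (u n) μ) :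
    ∃ φ : ℕ → ℕ, StrictMono φ ∧ ∀ (m : ℕ) (F : BoundedContinuousFunction (X × S) ℝ), ∃ l,
      Tendsto (fun j => ∫ x, clamp m (u (φ j) x) * F (x, τ (φ j) x) ∂μ) atTop (𝓝 l) := by
  have hum : ∀ n (m : ℕ), AEStronglyMeasurable (fun x => clamp m (u n x)) μ := fun n m =>
    (continuous_clamp _).comp_aestronglyMeasurable (hu n)
  have hub : ∀ n (m : ℕ) x, |clamp m (u n x)| ≤ m := fun n m x => abs_clamp_le m.cast_nonneg _
  have hlip : ∀ n (m : ℕ) (v w : Lp C(S, ℝ) 1 μ),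
      |∫ x, clamp m (u n x) * v x (τ n x) ∂μ - ∫ x, clamp m (u n x) * w x (τ n x) ∂μ| ≤
        m * dist v w := by
    intro n m v w
    refine (abs_integral_mul_trace_sub_le (L1.integrable_coeFn v) (L1.integrable_coeFn w) (hτ n)
      (hum n m) (hub n m)).trans_eq ?_
    rw [dist_eq_norm, L1.norm_eq_integral_norm]
    congr 1
    refine integral_congr_ae ?_
    filter_upwards [Lp.coeFn_sub v w] with x hx
    rw [hx, Pi.sub_apply]
  have : Fact ((1 : ℝ≥0∞) ≠ ∞) := ⟨ENNReal.one_ne_top⟩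
  obtain ⟨φ, hφ, hl⟩ := exists_subseq_forall_tendsto
    (F := fun n m (v : Lp C(S, ℝ) 1 μ) => ∫ x, clamp m (u n x) * v x (τ n x) ∂μ)
    (c := fun m => m) hlip (fun m v => ⟨m * dist v 0, fun n => by
      have h0 : ∫ x, clamp m (u n x) * (0 : Lp C(S, ℝ) 1 μ) x (τ n x) ∂μ = 0 := by
        refine integral_eq_zero_of_ae ?_
        filter_upwards [Lp.coeFn_zero C(S, ℝ) 1 μ] with x hx
        rw [hx]
        simp
      have := hlip n m v 0
      rwa [h0, sub_zero] at this⟩)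
  refine ⟨φ, hφ, fun m F => ?_⟩
  obtain ⟨l, hl⟩ := hl m ((integrable_curry F).toL1 _)
  refine ⟨l, hl.congr fun j => integral_congr_ae ?_⟩
  filter_upwards [(integrable_curry (μ := μ) F).coeFn_toL1] with x hx
  rw [hx]
  rfl

/-- Limits of a sequence bounded in `L^B(μ)`, tested against traces of bounded continuous functions,
are represented along a subsequence by an integrable function on `X × S`. Each truncation has a limit
by `exists_integrable_repr`, and these limits are Cauchy in `L¹` by uniform integrability. -/
theorem IsNFunction.exists_subseq_tendsto_boundedContinuous (hB : IsNFunction B)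
    [IsFiniteMeasure μ] [IsProbabilityMeasure σ] {τ : ℕ → X → S} (hτ : Mixing μ σ τ)
    {K : ℝ} (hK : 0 < K) {u : ℕ → X → ℝ} (hu : ∀ n, AEStronglyMeasurable (u n) μ)
    (huB : ∀ n, Integrable (fun x => B (|u n x| / K)) μ)
    (huB1 : ∀ n, ∫ x, B (|u n x| / K) ∂μ ≤ 1) :
    ∃ φ : ℕ → ℕ, StrictMono φ ∧ ∃ h : X × S → ℝ, Integrable h (μ.prod σ) ∧
      ∀ F : BoundedContinuousFunction (X × S) ℝ,
        Tendsto (fun j => ∫ x, u (φ j) x * F (x, τ (φ j) x) ∂μ) atTop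
          (𝓝 (∫ p, h p * F p ∂(μ.prod σ))) := by
  obtain ⟨φ, hφ, hlim⟩ := exists_subseq_tendsto_clamp hτ.measurable hu
  choose Λ hΛ using hlim
  have hτφ := hτ.comp hφ
  have hFm : ∀ (F : BoundedContinuousFunction (X × S) ℝ) n,
      AEStronglyMeasurable (fun x => F (x, τ n x)) μ := fun F n =>
    F.continuous.comp_aestronglyMeasurable
      (measurable_id.prodMk (hτ.measurable n)).aestronglyMeasurable
  have hum : ∀ n (m : ℕ), Integrable (fun x => clamp m (u n x)) μ := fun n m =>
    Integrable.of_bound ((continuous_clamp _).comp_aestronglyMeasurable (hu n)) m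
      (Eventually.of_forall fun x => abs_clamp_le m.cast_nonneg _)
  have hui : ∀ n, Integrable (u n) μ := fun n => hB.integrable_of_modular hK (hu n) (huB n)
  have hmulF : ∀ (F : BoundedContinuousFunction (X × S) ℝ) n {v : X → ℝ}, Integrable v μ →
      Integrable (fun x => v x * F (x, τ n x)) μ := fun F n v hv =>
    hv.mul_bdd (hFm F n) (Eventually.of_forall fun x => F.norm_coe_le_norm _)
  have hΛadd : ∀ m F G, Λ m (F + G) = Λ m F + Λ m G := fun m F G => by
    refine tendsto_nhds_unique (hΛ m (F + G)) (((hΛ m F).add (hΛ m G)).congr fun j => ?_)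
    rw [← integral_add (hmulF F _ (hum _ m)) (hmulF G _ (hum _ m))]
    simp only [BoundedContinuousFunction.add_apply, mul_add]
  have hΛsmul : ∀ m (c : ℝ) F, Λ m (c • F) = c * Λ m F := fun m c F => by
    refine tendsto_nhds_unique (hΛ m (c • F)) (((hΛ m F).const_mul c).congr fun j => ?_)
    rw [← integral_const_mul]
    refine integral_congr_ae (Eventually.of_forall fun x => ?_)
    simp only [BoundedContinuousFunction.smul_apply, smul_eq_mul]
    ring
  have hΛle : ∀ (m : ℕ) F, |Λ m F| ≤ m * ∫ p, |F p| ∂(μ.prod σ) := fun m F => by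
    obtain ⟨G, hG⟩ := exists_boundedContinuous_comp _root_.continuous_abs F
    have h1 := (hτφ.tendsto_boundedContinuous G).const_mul (m : ℝ)
    simp only [hG] at h1
    refine le_of_tendsto_of_tendsto' (hΛ m F).abs h1 fun j => ?_
    rw [← integral_const_mul, ← Real.norm_eq_abs]
    refine norm_integral_le_of_norm_le ?_ (Eventually.of_forall fun x => ?_)
    · exact (Integrable.of_bound (hFm F _) ‖F‖
        (Eventually.of_forall fun x => F.norm_coe_le_norm _)).abs.const_mul _
    · rw [norm_mul]
      exact mul_le_mul_of_nonneg_right (abs_clamp_le m.cast_nonneg _) (norm_nonneg _)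
  have hrepr : ∀ m : ℕ, ∃ h : X × S → ℝ, Integrable h (μ.prod σ) ∧
      ∀ F, Λ m F = ∫ p, h p * F p ∂(μ.prod σ) := fun m =>
    exists_integrable_repr { toFun := Λ m, map_add' := hΛadd m, map_smul' := hΛsmul m }
      m.cast_nonneg (hΛle m)
  choose h hhi hh using hrepr
  have hhF : ∀ (F : BoundedContinuousFunction (X × S) ℝ) {v : X × S → ℝ},
      Integrable v (μ.prod σ) → Integrable (fun p => v p * F p) (μ.prod σ) := fun F v hv =>
    hv.mul_bdd F.continuous.aestronglyMeasurable
      (Eventually.of_forall fun p => F.norm_coe_le_norm p)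
  have hcau : ∀ η > 0, ∃ M, ∀ m ≥ M, ∀ m' ≥ M, ∫ p, |h m p - h m' p| ∂(μ.prod σ) ≤ η := by
    intro η hη
    obtain ⟨M, hM⟩ := hB.exists_forall_integral_sub_clamp_le hK hu huB huB1 (half_pos hη)
    refine ⟨M, fun m hm m' hm' => integral_abs_le_of_forall_boundedContinuous
      ((hhi m).sub (hhi m')) fun F hF => ?_⟩
    have h1 : ∫ p, (h m p - h m' p) * F p ∂(μ.prod σ) = Λ m F - Λ m' F := by
      rw [hh, hh, ← integral_sub (hhF F (hhi m)) (hhF F (hhi m'))]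
      simp only [sub_mul]
    simp only [Pi.sub_apply]
    rw [h1]
    refine le_of_tendsto' ((hΛ m F).sub (hΛ m' F)) fun j => ?_
    rw [← integral_sub (hmulF F _ (hum _ m)) (hmulF F _ (hum _ m'))]
    have hd : ∀ k : ℕ, Integrable (fun x => |u (φ j) x - clamp k (u (φ j) x)|) μ := fun k =>
      ((hui _).sub (hum _ k)).abs
    have h2 := add_le_add (hM m hm (φ j)) (hM m' hm' (φ j))
    rw [← integral_add (hd m) (hd m'), add_halves] at h2
    refine (integral_mono ((hmulF F _ (hum _ m)).sub (hmulF F _ (hum _ m')))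
      ((hd m).add (hd m')) fun x => ?_).trans h2
    simp only [Pi.sub_apply, Pi.add_apply]
    rw [← sub_mul]
    refine (le_abs_self _).trans ?_
    rw [abs_mul]
    refine (mul_le_of_le_one_right (abs_nonneg _) (hF _)).trans ?_
    rw [abs_sub_comm (u (φ j) x)]
    exact abs_sub_le _ _ _
  obtain ⟨g, hg, hgl⟩ := exists_integrable_tendsto_of_cauchy hhi hcau
  refine ⟨φ, hφ, g, hg, fun F => tendsto_of_forall_approx fun η hη => ?_⟩
  -- Replace `u` and `g` by a truncation and its limit `h m`, uniformly in the index.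
  have hpos : 0 < η / (‖F‖ + 1) := by positivity
  obtain ⟨M, hM⟩ := hB.exists_forall_integral_sub_clamp_le hK hu huB huB1 hpos
  obtain ⟨m, hm1, hm2⟩ := ((hgl.eventually_le_const hpos).and (eventually_ge_atTop M)).exists
  have hη' : ∀ t ≤ η / (‖F‖ + 1), ‖F‖ * t ≤ η := fun t ht => by
    have h1 := mul_le_mul_of_nonneg_left ht (norm_nonneg F)
    refine h1.trans ?_
    rw [mul_div_assoc', div_le_iff₀ (by positivity)]
    nlinarith [norm_nonneg F]
  refine ⟨_, _, hΛ m F, fun j => ?_, ?_⟩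
  · rw [← integral_sub (hmulF F _ (hui _)) (hmulF F _ (hum _ m)), ← Real.norm_eq_abs]
    refine (norm_integral_le_of_norm_le (((hui _).sub (hum _ m)).abs.const_mul ‖F‖)
      (Eventually.of_forall fun x => ?_)).trans
        ((integral_const_mul _ _).trans_le (hη' _ (hM m hm2 (φ j))))
    rw [← sub_mul, norm_mul, mul_comm]
    exact mul_le_mul_of_nonneg_right (F.norm_coe_le_norm _) (abs_nonneg _)
  · rw [hh, ← integral_sub (hhF F hg) (hhF F (hhi m)), ← Real.norm_eq_abs]
    refine (norm_integral_le_of_norm_le ((hg.sub (hhi m)).abs.const_mul ‖F‖)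
      (Eventually.of_forall fun p => ?_)).trans
        ((integral_const_mul _ _).trans_le (hη' _ hm1))
    rw [← sub_mul, norm_mul, mul_comm]
    exact mul_le_mul_of_nonneg_right (F.norm_coe_le_norm _) (abs_nonneg _)

/-- The compactness theorem in abstract form: the maps `τ n` play the role of
`x ↦ (x / ε n, x / ε n ^ 2)` with values in a torus. -/
theorem IsNFunction.exists_subseq_tendsto (hB : IsNFunction B)
    [IsFiniteMeasure μ] [IsProbabilityMeasure σ] {τ : ℕ → X → S} (hτ : Mixing μ σ τ)
    {K : ℝ} (hK : 0 < K) {u : ℕ → X → ℝ} (hu : ∀ n, AEStronglyMeasurable (u n) μ)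
    (huB : ∀ n, Integrable (fun x => B (|u n x| / K)) μ)
    (huB1 : ∀ n, ∫ x, B (|u n x| / K) ∂μ ≤ 1) :
    ∃ φ : ℕ → ℕ, StrictMono φ ∧ ∃ h : X × S → ℝ, StronglyMeasurable h ∧
      ∫⁻ p, ENNReal.ofReal (B (|h p| / K)) ∂(μ.prod σ) ≤ 1 ∧
      ∀ f : X → C(S, ℝ), AEStronglyMeasurable f μ →
        (∀ c : ℝ, 0 < c → Integrable (fun x => conj B (c * ‖f x‖)) μ) →
        Tendsto (fun j => ∫ x, u (φ j) x * f x (τ (φ j) x) ∂μ) atTop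
          (𝓝 (∫ p, h p * f p.1 p.2 ∂(μ.prod σ))) := by
  obtain ⟨φ, hφ, h₀, hh₀, hlim₀⟩ := hB.exists_subseq_tendsto_boundedContinuous hτ hK hu huB huB1
  set h := hh₀.1.mk h₀ with hh
  have hhsm : StronglyMeasurable h := hh₀.1.stronglyMeasurable_mk
  have hhi : Integrable h (μ.prod σ) := hh₀.congr hh₀.1.ae_eq_mk
  have hlim : ∀ F : BoundedContinuousFunction (X × S) ℝ,
      Tendsto (fun j => ∫ x, u (φ j) x * F (x, τ (φ j) x) ∂μ) atTop
        (𝓝 (∫ p, h p * F p ∂(μ.prod σ))) := fun F => by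
    rw [show ∫ p, h p * F p ∂(μ.prod σ) = ∫ p, h₀ p * F p ∂(μ.prod σ) from
      integral_congr_ae (hh₀.1.ae_eq_mk.mono fun p hp => by simp only [hh, ← hp])]
    exact hlim₀ F
  have hui : ∀ n, Integrable (u n) μ := fun n => hB.integrable_of_modular hK (hu n) (huB n)
  have hFm : ∀ (F : BoundedContinuousFunction (X × S) ℝ) n,
      AEStronglyMeasurable (fun x => F (x, τ n x)) μ := fun F n =>
    F.continuous.comp_aestronglyMeasurable
      (measurable_id.prodMk (hτ.measurable n)).aestronglyMeasurable
  have hcont : Continuous fun t => conj B |t| := hB.continuous_conj.comp _root_.continuous_abs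
  have hmod : ∫⁻ p, ENNReal.ofReal (B |h p / K|) ∂(μ.prod σ) ≤ 1 := by
    refine hB.lintegral_le_one_of_forall_boundedContinuous (hhi.div_const K)
      (hhsm.measurable.div_const K) fun F => ?_
    obtain ⟨G, hG⟩ := exists_boundedContinuous_comp hcont F
    have h1 := ((hτ.comp hφ).tendsto_boundedContinuous G).const_add 1
    have h2 := (hlim F).div_const K
    have h3 : ∫ p, h p / K * F p ∂(μ.prod σ) = (∫ p, h p * F p ∂(μ.prod σ)) / K := by
      rw [← integral_div]
      simp only [div_mul_eq_mul_div]
    rw [h3]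
    simp only [hG] at h1
    refine le_of_tendsto_of_tendsto' h2 h1 fun j => ?_
    have hGi : Integrable (fun x => conj B |F (x, τ (φ j) x)|) μ := by
      refine Integrable.of_bound (hcont.comp_aestronglyMeasurable (hFm F _)) (conj B ‖F‖)
        (Eventually.of_forall fun x => ?_)
      rw [Real.norm_of_nonneg (hB.conj_nonneg _)]
      exact hB.conj_mono (F.norm_coe_le_norm _)
    have huF : Integrable (fun x => u (φ j) x * F (x, τ (φ j) x)) μ :=
      (hui _).mul_bdd (hFm F _) (Eventually.of_forall fun x => F.norm_coe_le_norm _)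
    have h4 := integral_mono (huF.div_const K) ((huB (φ j)).add hGi) fun x => by
      have h5 := hB.young (s := |u (φ j) x| / K) (by positivity) |F (x, τ (φ j) x)|
      refine le_trans ?_ h5
      rw [div_mul_eq_mul_div, ← abs_mul]
      exact div_le_div_of_nonneg_right (le_abs_self _) hK.le
    simp only [Pi.add_apply] at h4
    rw [integral_div, integral_add (huB (φ j)) hGi] at h4
    exact h4.trans (add_le_add_left (huB1 (φ j)) _)
  have hmod' : ∫⁻ p, ENNReal.ofReal (B (|h p| / K)) ∂(μ.prod σ) ≤ 1 := by
    simpa only [abs_div, abs_of_pos hK] using hmod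
  obtain ⟨hBhi, hBh1⟩ := hB.integrable_modular hhi.1 hK hmod'
  refine ⟨φ, hφ, h, hhsm, hmod', fun f hf hfB => tendsto_of_forall_approx fun η hη => ?_⟩
  -- With this scaling, functions `w` with `∫ B̃ (c * w) ≤ 1` satisfy `∫ |u n| * w ≤ η`.
  set c : ℝ := 2 * K / η with hc
  have hc0 : 0 < c := by positivity
  obtain ⟨F, hFi, hF1⟩ := hB.exists_boundedContinuous_conj_le hf hfB hc0
  set w : X → ℝ := fun x => ‖f x - F.toContinuousMap.curry x‖ with hw
  have hwm : AEStronglyMeasurable w μ :=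
    (hf.sub F.toContinuousMap.curry.continuous.aestronglyMeasurable).norm
  have hw0 : ∀ x, 0 ≤ w x := fun x => norm_nonneg _
  have hfi : Integrable f μ := (integrable_norm_iff hf).1
    (hB.integrable_of_conj_modular hf.norm (fun x => norm_nonneg _) (hfB 1 one_pos))
  have hKc : K / c * (1 + 1) = η := by rw [hc]; field_simp; norm_num
  have hsub : ∀ x s, |f x s - F (x, s)| ≤ w x := fun x s =>
    (f x - F.toContinuousMap.curry x).norm_coe_le_norm s
  have hfm : ∀ x, ‖f x‖ ≤ ‖F‖ + w x := fun x => by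
    have h1 : ‖F.toContinuousMap.curry x‖ ≤ ‖F‖ :=
      (ContinuousMap.norm_le _ (norm_nonneg _)).2 fun s => F.norm_coe_le_norm (x, s)
    have h2 := norm_le_norm_add_norm_sub' (f x) (F.toContinuousMap.curry x)
    simp only [hw]
    linarith
  refine ⟨_, _, hlim F, fun j => ?_, ?_⟩
  · obtain ⟨hyi, hy⟩ := hB.integral_mul_le hK hc0 (hu (φ j)) hwm hw0 (huB (φ j)) hFi
    have huF : Integrable (fun x => u (φ j) x * F (x, τ (φ j) x)) μ :=
      (hui _).mul_bdd (hFm F _) (Eventually.of_forall fun x => F.norm_coe_le_norm _)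
    have huf : Integrable (fun x => u (φ j) x * f x (τ (φ j) x)) μ := by
      refine (((hui (φ j)).abs.mul_const ‖F‖).add hyi).mono'
        ((hu _).mul (aestronglyMeasurable_trace hf (hτ.measurable _)))
        (Eventually.of_forall fun x => ?_)
      rw [norm_mul]
      simp only [Pi.add_apply]
      rw [← mul_add]
      exact mul_le_mul_of_nonneg_left (((f x).norm_coe_le_norm _).trans (hfm x)) (abs_nonneg _)
    rw [← integral_sub huf huF, ← Real.norm_eq_abs]
    refine (norm_integral_le_of_norm_le hyi (Eventually.of_forall fun x => ?_)).trans
      (hy.trans (le_trans ?_ hKc.le))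
    · rw [← mul_sub, norm_mul]
      exact mul_le_mul_of_nonneg_left (hsub _ _) (abs_nonneg _)
    · exact mul_le_mul_of_nonneg_left (add_le_add (huB1 _) hF1) (by positivity)
  · have hw1 : Integrable (fun p : X × S => conj B (c * w p.1)) (μ.prod σ) := hFi.comp_fst σ
    obtain ⟨hyi, hy⟩ := hB.integral_mul_le (μ := μ.prod σ) (w := fun p : X × S => w p.1) hK hc0
      hhi.1 hwm.comp_fst (fun p => hw0 p.1) hBhi hw1
    rw [integral_fun_fst (fun x => conj B (c * w x))] at hy
    simp only [probReal_univ, one_smul] at hy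
    have hhF : Integrable (fun p => h p * F p) (μ.prod σ) :=
      hhi.mul_bdd F.continuous.aestronglyMeasurable
        (Eventually.of_forall fun p => F.norm_coe_le_norm p)
    have hhf : Integrable (fun p => h p * f p.1 p.2) (μ.prod σ) := by
      refine ((hhi.abs.mul_const ‖F‖).add hyi).mono'
        (hhi.1.mul (aestronglyMeasurable_eval hf)) (Eventually.of_forall fun p => ?_)
      rw [norm_mul]
      simp only [Pi.add_apply]
      rw [← mul_add]
      exact mul_le_mul_of_nonneg_left (((f p.1).norm_coe_le_norm _).trans (hfm p.1)) (abs_nonneg _)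
    rw [← integral_sub hhf hhF, ← Real.norm_eq_abs]
    refine (norm_integral_le_of_norm_le hyi (Eventually.of_forall fun p => ?_)).trans
      (hy.trans (le_trans ?_ hKc.le))
    · rw [← mul_sub, norm_mul]
      exact mul_le_mul_of_nonneg_left (hsub _ _) (abs_nonneg _)
    · exact mul_le_mul_of_nonneg_left (add_le_add hBh1 hF1) (by positivity)

end Compactness

/-! ### The torus -/

section Torus

variable {N : ℕ}

/-- The torus `(ℝ/ℤ)^N × (ℝ/ℤ)^N`, on which `ℤ^N × ℤ^N`-periodic functions live. -/
abbrev Torus (N : ℕ) : Type := UnitAddTorus (Fin N ⊕ Fin N)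

/-- The normalized Haar measure of the torus. -/
noncomputable def torusMeasure (N : ℕ) : Measure (Torus N) :=
  Measure.pi fun _ => AddCircle.haarAddCircle

instance : IsProbabilityMeasure (torusMeasure N) := by
  unfold torusMeasure
  infer_instance

/-- The `2N` coordinates of a point of `ℝ^N × ℝ^N`, as a homeomorphism. -/
noncomputable def coord (N : ℕ) : E N × E N ≃ₜ (Fin N ⊕ Fin N → ℝ) where
  toFun p := Sum.elim p.1 p.2
  invFun v := (WithLp.toLp 2 fun i => v (Sum.inl i), WithLp.toLp 2 fun i => v (Sum.inr i))
  left_inv p := rfl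
  right_inv v := by
    funext i
    rcases i with i | i <;> rfl
  continuous_toFun := by
    refine continuous_pi fun i => ?_
    rcases i with i | i <;> simp only [Sum.elim_inl, Sum.elim_inr] <;> fun_prop
  continuous_invFun := by fun_prop

/-- The quotient map of `ℝ^N × ℝ^N` onto the torus. -/
noncomputable def toTorus (p : E N × E N) : Torus N := fun i => (coord N p i : UnitAddCircle)

theorem isOpenQuotientMap_toTorus : IsOpenQuotientMap (toTorus (N := N)) :=
  (IsOpenQuotientMap.piMap fun _ => QuotientAddGroup.isOpenQuotientMap_mk).comp
    (coord N).isOpenQuotientMap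

theorem continuous_toTorus : Continuous (toTorus (N := N)) :=
  isOpenQuotientMap_toTorus.continuous

theorem measurePreserving_coord : MeasurePreserving (coord N) volume volume :=
  (volume_measurePreserving_sumPiEquivProdPi_symm (fun _ : Fin N ⊕ Fin N => ℝ)).comp
    ((PiLp.volume_preserving_ofLp (Fin N)).prod (PiLp.volume_preserving_ofLp (Fin N)))

/-- Half-open unit boxes in `ℝ^N × ℝ^N`. -/
def box (a : Fin N ⊕ Fin N → ℝ) : Set (E N × E N) :=
  coord N ⁻¹' {v | ∀ i, v i ∈ Ioc (a i) (a i + 1)}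

/-- Every half-open unit box is a fundamental domain of the torus. -/
theorem map_toTorus_box (a : Fin N ⊕ Fin N → ℝ) :
    Measure.map toTorus (volume.restrict (box a)) = torusMeasure N := by
  have hm : MeasurableSet {v : Fin N ⊕ Fin N → ℝ | ∀ i, v i ∈ Ioc (a i) (a i + 1)} := by
    have : {v : Fin N ⊕ Fin N → ℝ | ∀ i, v i ∈ Ioc (a i) (a i + 1)} =
        univ.pi fun i => Ioc (a i) (a i + 1) := by ext; simp
    rw [this]
    exact MeasurableSet.univ_pi fun i => measurableSet_Ioc
  have hq : Measurable fun (v : Fin N ⊕ Fin N → ℝ) (i : Fin N ⊕ Fin N) => (v i : UnitAddCircle) :=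
    measurable_pi_lambda _ fun i => AddCircle.measurable_mk'.comp (measurable_pi_apply i)
  have h1 : Measure.map (fun (v : Fin N ⊕ Fin N → ℝ) (i : Fin N ⊕ Fin N) => (v i : UnitAddCircle))
      (volume.restrict {v | ∀ i, v i ∈ Ioc (a i) (a i + 1)}) = torusMeasure N := by
    refine Measure.ext fun s hs => ?_
    rw [← lintegral_indicator_one hs, lintegral_map (measurable_one.indicator hs) hq,
      ← lintegral_indicator_one hs]
    exact (UnitAddTorus.lintegral_preimage (s.indicator 1) a).symm
  have h2 := (measurePreserving_coord (N := N)).restrict_preimage hm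
  rw [← h1, ← h2.map_eq, Measure.map_map hq h2.measurable]
  rfl

theorem cell_prod_ae_eq_box :
    (cell N ×ˢ cell N : Set (E N × E N)) =ᵐ[volume] box (fun _ => -(1 / 2)) := by
  have h1 : (cell N ×ˢ cell N : Set (E N × E N)) =
      coord N ⁻¹' (univ.pi fun _ => Ioo (-(1 / 2) : ℝ) (1 / 2)) := by
    ext p
    simp only [mem_prod, mem_preimage, mem_univ_pi, Sum.forall]
    rfl
  have h2 : box (N := N) (fun _ => -(1 / 2)) =
      coord N ⁻¹' (univ.pi fun _ => Ioc (-(1 / 2) : ℝ) (1 / 2)) := by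
    ext p
    have : (-(1 / 2) + 1 : ℝ) = 1 / 2 := by norm_num
    simp only [box, mem_preimage, this, mem_univ_pi]
    rfl
  rw [h1, h2]
  refine (measurePreserving_coord (N := N)).quasiMeasurePreserving.preimage_ae_eq ?_
  exact (Measure.univ_pi_Ioo_ae_eq_Icc (f := fun _ => (-(1 / 2) : ℝ)) (g := fun _ => 1 / 2)).trans
    (Measure.univ_pi_Ioc_ae_eq_Icc (f := fun _ => (-(1 / 2) : ℝ)) (g := fun _ => 1 / 2)).symm

theorem map_toTorus_cell :
    Measure.map toTorus (volume.restrict (cell N ×ˢ cell N)) = torusMeasure N := by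
  rw [Measure.restrict_congr_set cell_prod_ae_eq_box, map_toTorus_box]

/-- A bounded set is covered by finitely many unit boxes, so its image measure on the torus is
bounded by a multiple of the Haar measure. -/
theorem exists_map_toTorus_le {K : Set (E N × E N)} (hK : Bornology.IsBounded K) :
    ∃ c : ℝ≥0∞, c ≠ ∞ ∧ Measure.map toTorus (volume.restrict K) ≤ c • torusMeasure N := by
  obtain ⟨R, hR⟩ := hK.exists_norm_le
  obtain ⟨m, hm⟩ := exists_nat_ge (R + 1)
  set T : Finset (Fin N ⊕ Fin N → ℤ) :=
    Fintype.piFinset fun _ => Finset.Icc (-(m : ℤ)) m with hT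
  have hcover : K ⊆ ⋃ k ∈ T, box fun i => (k i : ℝ) := by
    intro p hp
    have hcoord : ∀ i, |coord N p i| ≤ R := fun i => by
      refine le_trans ?_ (hR p hp)
      rcases i with i | i
      · exact (PiLp.norm_apply_le p.1 i).trans (norm_fst_le p)
      · exact (PiLp.norm_apply_le p.2 i).trans (norm_snd_le p)
    refine mem_iUnion₂.2 ⟨fun i => ⌈coord N p i⌉ - 1, ?_, fun i => ?_⟩
    · refine Fintype.mem_piFinset.2 fun i => Finset.mem_Icc.2 ?_
      have h1 := abs_le.1 (hcoord i)
      have h2 := Int.le_ceil (coord N p i)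
      have h3 := Int.ceil_lt_add_one (coord N p i)
      constructor
      · have : ((-(m : ℤ) : ℤ) : ℝ) ≤ ((⌈coord N p i⌉ - 1 : ℤ) : ℝ) := by
          push_cast
          linarith
        exact_mod_cast this
      · have : ((⌈coord N p i⌉ - 1 : ℤ) : ℝ) ≤ ((m : ℤ) : ℝ) := by
          push_cast
          linarith
        exact_mod_cast this
    · have h2 := Int.le_ceil (coord N p i)
      have h3 := Int.ceil_lt_add_one (coord N p i)
      rw [mem_Ioc]
      push_cast
      constructor <;> linarith
  refine ⟨T.card, ENNReal.natCast_ne_top _, Measure.le_iff.2 fun s hs => ?_⟩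
  have hq := continuous_toTorus.measurable (α := E N × E N)
  rw [Measure.map_apply hq hs, Measure.smul_apply, smul_eq_mul]
  refine (Measure.restrict_mono_set volume hcover _).trans ?_
  rw [Measure.restrict_apply (hq hs), inter_iUnion₂]
  refine (measure_biUnion_finset_le T _).trans ?_
  rw [← nsmul_eq_mul]
  refine Finset.sum_le_card_nsmul _ _ _ fun k _ => ?_
  rw [← map_toTorus_box fun i => (k i : ℝ), Measure.map_apply hq hs, Measure.restrict_apply (hq hs)]

theorem exists_lintegral_toTorus_le {K : Set (E N × E N)} (hK : Bornology.IsBounded K) :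
    ∃ c : ℝ≥0∞, c ≠ ∞ ∧ ∀ g : Torus N → ℝ≥0∞, Measurable g →
      ∫⁻ p in K, g (toTorus p) ≤ c * ∫⁻ s, g s ∂(torusMeasure N) := by
  obtain ⟨c, hc, hle⟩ := exists_map_toTorus_le hK
  refine ⟨c, hc, fun g hg => ?_⟩
  rw [← lintegral_map hg continuous_toTorus.measurable, ← smul_eq_mul, ← lintegral_smul_measure]
  exact lintegral_mono' hle le_rfl

theorem exists_eq_add_intVec_of_toTorus_eq {p p' : E N × E N} (h : toTorus p = toTorus p') :
    ∃ k l : Fin N → ℤ, p' = (p.1 + intVec k, p.2 + intVec l) := by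
  have key : ∀ i, ∃ n : ℤ, coord N p' i = coord N p i + n := fun i => by
    have h1 : ((coord N p' i - coord N p i : ℝ) : UnitAddCircle) = 0 := by
      rw [AddCircle.coe_sub, sub_eq_zero]
      exact (congrFun h i).symm
    obtain ⟨n, hn⟩ := (AddCircle.coe_eq_zero_iff _).1 h1
    refine ⟨n, ?_⟩
    rw [zsmul_eq_mul, mul_one] at hn
    linarith
  choose n hn using key
  refine ⟨fun i => n (Sum.inl i), fun i => n (Sum.inr i), Prod.ext ?_ ?_⟩
  · ext i
    exact hn (Sum.inl i)
  · ext i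
    exact hn (Sum.inr i)

theorem toTorus_add_intVec (k l : Fin N → ℤ) (p : E N × E N) :
    toTorus (p.1 + intVec k, p.2 + intVec l) = toTorus p := by
  have hint : ∀ n : ℤ, ((n : ℝ) : UnitAddCircle) = 0 := fun n =>
    (AddCircle.coe_eq_zero_iff _).2 ⟨n, by simp⟩
  funext i
  rcases i with i | i
  · change ((p.1 i + (k i : ℝ) : ℝ) : UnitAddCircle) = ((p.1 i : ℝ) : UnitAddCircle)
    rw [AddCircle.coe_add, hint, add_zero]
  · change ((p.2 i + (l i : ℝ) : ℝ) : UnitAddCircle) = ((p.2 i : ℝ) : UnitAddCircle)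
    rw [AddCircle.coe_add, hint, add_zero]

theorem factorsThrough_toTorus (w : Cper N) : Function.FactorsThrough
    (w : BoundedContinuousFunction (E N × E N) ℝ).toContinuousMap
    (⟨toTorus, continuous_toTorus⟩ : C(E N × E N, Torus N)) := fun p p' h => by
  obtain ⟨k, l, rfl⟩ := exists_eq_add_intVec_of_toTorus_eq (show toTorus p = toTorus p' from h)
  exact (w.2 k l p.1 p.2).symm

/-- The continuous function on the torus induced by a periodic function. -/
noncomputable def descend (w : Cper N) : C(Torus N, ℝ) :=
  IsQuotientMap.lift isOpenQuotientMap_toTorus.isQuotientMap _ (factorsThrough_toTorus w)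

theorem descend_toTorus (w : Cper N) (p : E N × E N) :
    descend w (toTorus p) = (w : BoundedContinuousFunction (E N × E N) ℝ) p :=
  DFunLike.congr_fun (IsQuotientMap.lift_comp isOpenQuotientMap_toTorus.isQuotientMap _
    (factorsThrough_toTorus w)) p

theorem norm_descend_le (w : Cper N) : ‖descend w‖ ≤ ‖w‖ := by
  refine (ContinuousMap.norm_le _ (norm_nonneg w)).2 fun t => ?_
  obtain ⟨p, rfl⟩ := isOpenQuotientMap_toTorus.surjective t
  rw [descend_toTorus]
  exact (w : BoundedContinuousFunction (E N × E N) ℝ).norm_coe_le_norm p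

theorem continuous_descend : Continuous (descend (N := N)) := by
  refine (LipschitzWith.of_dist_le_mul (K := 1) fun w w' => ?_).continuous
  rw [NNReal.coe_one, one_mul]
  refine (ContinuousMap.dist_le dist_nonneg).2 fun t => ?_
  obtain ⟨p, rfl⟩ := isOpenQuotientMap_toTorus.surjective t
  rw [descend_toTorus, descend_toTorus]
  exact BoundedContinuousFunction.dist_coe_le_dist (f := (w : BoundedContinuousFunction _ ℝ))
    (g := (w' : BoundedContinuousFunction _ ℝ)) p

end Torus

/-! ### Mixing of the two scales -/

section MixingTorus

variable {N : ℕ}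

open UnitAddTorus

theorem integral_mFourier_of_ne_zero {k : Fin N ⊕ Fin N → ℤ} (hk : k ≠ 0) :
    ∫ t, mFourier k t ∂(torusMeasure N) = 0 := by
  have h := (orthonormal_iff_ite.1 (orthonormal_mFourier (d := Fin N ⊕ Fin N))) 0 k
  rw [if_neg hk.symm, mFourierLp, mFourierLp, ContinuousMap.inner_toLp] at h
  rw [← h]
  simp [mFourier_zero]
  rfl

/-- The frequency vector of the character `mFourier k` read along `x ↦ (x / ε, x / ε²)`. -/
noncomputable def freq (k : Fin N ⊕ Fin N → ℤ) (ε : ℝ) : E N :=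
  ε⁻¹ • intVec (fun i => k (Sum.inl i)) + (ε ^ 2)⁻¹ • intVec (fun i => k (Sum.inr i))

/-- The torus point of `(x / ε, x / ε²)`. -/
noncomputable def scalePoint (ε : ℝ) (x : E N) : Torus N := toTorus (ε⁻¹ • x, (ε ^ 2)⁻¹ • x)

theorem continuous_scalePoint (ε : ℝ) : Continuous (scalePoint (N := N) ε) :=
  continuous_toTorus.comp (by fun_prop)

theorem mFourier_scalePoint (k : Fin N ⊕ Fin N → ℤ) (ε : ℝ) (x : E N) :
    mFourier k (scalePoint ε x) = (Real.fourierChar (-inner ℝ x (-freq k ε)) : ℂ) := by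
  have h1 : mFourier k (scalePoint ε x) = ∏ i, fourier (k i) (scalePoint ε x i) := rfl
  rw [h1, Fintype.prod_sum_type]
  have h2 : ∀ i, fourier (k (Sum.inl i)) (scalePoint ε x (Sum.inl i)) =
      Complex.exp (2 * Real.pi * Complex.I * (k (Sum.inl i)) * (ε⁻¹ * x i : ℝ)) := fun i => by
    have : scalePoint ε x (Sum.inl i) = ((ε⁻¹ * x i : ℝ) : UnitAddCircle) := rfl
    rw [this, fourier_coe_apply]
    simp
  have h3 : ∀ i, fourier (k (Sum.inr i)) (scalePoint ε x (Sum.inr i)) =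
      Complex.exp (2 * Real.pi * Complex.I * (k (Sum.inr i)) * ((ε ^ 2)⁻¹ * x i : ℝ)) := fun i => by
    have : scalePoint ε x (Sum.inr i) = (((ε ^ 2)⁻¹ * x i : ℝ) : UnitAddCircle) := rfl
    rw [this, fourier_coe_apply]
    simp
  simp only [h2, h3]
  rw [← Complex.exp_sum, ← Complex.exp_sum, ← Complex.exp_add, Real.fourierChar_apply]
  congr 1
  rw [inner_neg_right, neg_neg, PiLp.inner_apply, ← Finset.sum_add_distrib]
  push_cast
  rw [Finset.mul_sum, Finset.sum_mul]
  refine Finset.sum_congr rfl fun i _ => ?_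
  simp [freq, intVec]
  ring

/-- Nonzero frequencies escape to infinity: in the coordinate `ε⁻¹ a + ε⁻² b` the second term
dominates unless the integer `b` vanishes. -/
theorem tendsto_freq_cobounded {ε : ℕ → ℝ} (hε : ∀ n, 0 < ε n) (hε0 : Tendsto ε atTop (𝓝 0))
    {k : Fin N ⊕ Fin N → ℤ} (hk : k ≠ 0) :
    Tendsto (fun n => freq k (ε n)) atTop (Bornology.cobounded (E N)) := by
  rw [← tendsto_norm_atTop_iff_cobounded]
  obtain ⟨i, hi⟩ : ∃ i, k (Sum.inl i) ≠ 0 ∨ k (Sum.inr i) ≠ 0 := by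
    obtain ⟨j, hj⟩ := Function.ne_iff.1 hk
    rcases j with i | i
    exacts [⟨i, Or.inl hj⟩, ⟨i, Or.inr hj⟩]
  refine tendsto_atTop_mono (fun n => PiLp.norm_apply_le (freq k (ε n)) i) ?_
  have hinv : Tendsto (fun n => (ε n)⁻¹) atTop atTop :=
    (tendsto_inv_nhdsGT_zero (𝕜 := ℝ)).comp
      (tendsto_nhdsWithin_iff.2 ⟨hε0, Eventually.of_forall hε⟩)
  set a : ℝ := Int.cast (k (Sum.inl i)) with ha
  set b : ℝ := Int.cast (k (Sum.inr i)) with hb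
  have hcoord : ∀ n, ‖freq k (ε n) i‖ = (ε n)⁻¹ * |a + (ε n)⁻¹ * b| := fun n => by
    have : freq k (ε n) i = (ε n)⁻¹ * (a + (ε n)⁻¹ * b) := by
      simp [freq, intVec, ha, hb]
      ring
    rw [this, Real.norm_eq_abs, abs_mul, abs_of_pos (inv_pos.2 (hε n))]
  simp only [hcoord]
  by_cases hb0 : k (Sum.inr i) = 0
  · have ha0 : 0 < |a| := abs_pos.2 (by
      rw [ha]
      exact_mod_cast hi.resolve_right (not_not.2 hb0))
    simp only [hb, hb0, Int.cast_zero, mul_zero, add_zero]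
    exact hinv.atTop_mul_const ha0
  · have hb1 : 0 < |b| := abs_pos.2 (by rw [hb]; exact_mod_cast hb0)
    refine hinv.atTop_mul_atTop₀ ?_
    refine tendsto_atTop_mono (fun n => ?_)
      (tendsto_atTop_add_const_right atTop (-|a|) (hinv.atTop_mul_const hb1))
    have h1 := abs_sub_abs_le_abs_sub ((ε n)⁻¹ * b) (-a)
    rw [abs_neg, abs_mul, abs_of_pos (inv_pos.2 (hε n)), sub_neg_eq_add, add_comm _ a] at h1
    linarith

/-- The mean value property of the two scales: for characters it is the Riemann–Lebesgue lemma, and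
the characters span a dense subspace of the continuous functions on the torus. -/
theorem mixing_scalePoint {ε : ℕ → ℝ} (hε : ∀ n, 0 < ε n) (hε0 : Tendsto ε atTop (𝓝 0))
    {Ω : Set (E N)} (hΩ : MeasurableSet Ω) :
    Mixing (volume.restrict Ω) (torusMeasure N) fun n => scalePoint (ε n) := by
  refine ⟨fun n => (continuous_scalePoint _).measurable, fun φ hφ w => ?_⟩
  have hmeas : ∀ (v : C(Torus N, ℂ)) n, AEStronglyMeasurable (fun x => v (scalePoint (ε n) x))
      (volume.restrict Ω) := fun v n =>
    (v.continuous.comp (continuous_scalePoint _)).aestronglyMeasurable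
  have hint : ∀ (v : C(Torus N, ℂ)) n, Integrable (fun x => (φ x : ℂ) * v (scalePoint (ε n) x))
      (volume.restrict Ω) := fun v n =>
    hφ.ofReal.mul_bdd (hmeas v n) (Eventually.of_forall fun x => v.norm_coe_le_norm _)
  have hintT : ∀ v : C(Torus N, ℂ), Integrable v (torusMeasure N) := fun v =>
    Integrable.of_bound v.continuous.aestronglyMeasurable ‖v‖
      (Eventually.of_forall fun t => v.norm_coe_le_norm t)
  set P : C(Torus N, ℂ) → Prop := fun v =>
    Tendsto (fun n => ∫ x in Ω, (φ x : ℂ) * v (scalePoint (ε n) x)) atTop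
      (𝓝 ((∫ x in Ω, (φ x : ℂ)) * ∫ t, v t ∂(torusMeasure N))) with hP
  have hchar : ∀ k, P (mFourier k) := fun k => by
    by_cases hk : k = 0
    · subst hk
      simp [hP, mFourier_zero]
    · simp only [hP]
      rw [integral_mFourier_of_ne_zero hk, mul_zero]
      have hneg : Tendsto (fun n => -freq k (ε n)) atTop (cocompact (E N)) := by
        rw [← Metric.cobounded_eq_cocompact]
        exact tendsto_neg_cobounded.comp (tendsto_freq_cobounded hε hε0 hk)
      refine ((tendsto_integral_exp_inner_smul_cocompact
        (Ω.indicator fun x => (φ x : ℂ))).comp hneg).congr fun n => ?_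
      rw [Function.comp_apply, ← integral_indicator hΩ]
      refine integral_congr_ae (Eventually.of_forall fun x => ?_)
      by_cases hx : x ∈ Ω
      · simp only [indicator_of_mem hx]
        rw [mFourier_scalePoint, Circle.smul_def, smul_eq_mul, mul_comm]
      · simp only [indicator_of_notMem hx, smul_zero]
  have hspan : ∀ v ∈ Submodule.span ℂ (range (mFourier (d := Fin N ⊕ Fin N))), P v := by
    intro v hv
    induction hv using Submodule.span_induction with
    | mem v hv =>
      obtain ⟨k, rfl⟩ := hv
      exact hchar k
    | zero => simp [hP]
    | add v v' _ _ hv hv' =>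
      simp only [hP, ContinuousMap.add_apply, mul_add] at hv hv' ⊢
      rw [integral_add (hintT v) (hintT v'), mul_add]
      refine (hv.add hv').congr fun n => ?_
      rw [integral_add (hint v n) (hint v' n)]
    | smul c v _ hv =>
      simp only [hP, ContinuousMap.smul_apply, smul_eq_mul] at hv ⊢
      rw [integral_const_mul, mul_left_comm]
      refine (hv.const_mul c).congr fun n => ?_
      rw [← integral_const_mul]
      simp only [mul_left_comm]
  have hall : ∀ v, P v := by
    intro v
    refine tendsto_of_forall_dist_approx fun η hη => ?_
    have hv : v ∈ closure (Submodule.span ℂ (range (mFourier (d := Fin N ⊕ Fin N))) :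
        Set C(Torus N, ℂ)) := by
      rw [← Submodule.topologicalClosure_coe, span_mFourier_closure_eq_top]
      trivial
    set I : ℝ := ∫ x in Ω, |φ x| with hI
    have hI0 : 0 ≤ I := integral_nonneg fun x => abs_nonneg _
    obtain ⟨v', hv', hd⟩ := Metric.mem_closure_iff.1 hv (η / (I + 1)) (by positivity)
    have hIη : I * ‖v - v'‖ ≤ η := by
      rw [dist_eq_norm, lt_div_iff₀ (by positivity)] at hd
      nlinarith [norm_nonneg (v - v')]
    refine ⟨_, _, hspan v' hv', fun n => ?_, ?_⟩
    · rw [dist_eq_norm, ← integral_sub (hint v n) (hint v' n)]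
      refine (norm_integral_le_of_norm_le (hφ.abs.mul_const ‖v - v'‖)
        (Eventually.of_forall fun x => ?_)).trans ((integral_mul_const _ _).trans_le hIη)
      rw [← mul_sub, norm_mul, Complex.norm_real]
      exact mul_le_mul_of_nonneg_left ((v - v').norm_coe_le_norm _) (norm_nonneg _)
    · rw [dist_eq_norm, ← mul_sub, norm_mul, ← integral_sub (hintT v) (hintT v')]
      refine le_trans (mul_le_mul ?_ ?_ (norm_nonneg _) hI0) hIη
      · refine (norm_integral_le_integral_norm _).trans_eq ?_
        simp [hI]
      · refine (norm_integral_le_of_norm_le (integrable_const ‖v - v'‖)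
          (Eventually.of_forall fun t => (v - v').norm_coe_le_norm t)).trans_eq ?_
        simp
  have h := hall ⟨fun t => (w t : ℂ), Complex.continuous_ofReal.comp w.continuous⟩
  simp only [hP, ContinuousMap.coe_mk, ← Complex.ofReal_mul] at h
  exact_mod_cast (Complex.continuous_re.tendsto _).comp h

end MixingTorus

/-! ### Periodic limits -/

section PeriodicLimit

variable {N : ℕ} {B : ℝ → ℝ} {Ω : Set (E N)}

/-- A function on `Ω × torus` as a periodic function on `Ω × ℝ^N × ℝ^N`. -/
noncomputable def periodize (h : E N × Torus N → ℝ) (p : E N × E N × E N) : ℝ := h (p.1, toTorus p.2)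

theorem map_prod_toTorus_cell [SFinite (volume.restrict Ω)] :
    Measure.map (Prod.map id toTorus) (volume.restrict (Ω ×ˢ cell N ×ˢ cell N)) =
      (volume.restrict Ω).prod (torusMeasure N) := by
  rw [Measure.volume_eq_prod, ← Measure.prod_restrict,
    ← Measure.map_prod_map _ _ measurable_id continuous_toTorus.measurable, Measure.map_id,
    map_toTorus_cell]

/-- A strongly measurable `h` of finite modular on `Ω × torus` induces an element of
`L^B_per(Ω × Y × Z)`. -/
theorem IsNFunction.memOrliczPer₃_periodize (hB : IsNFunction B) {h : E N × Torus N → ℝ}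
    (hh : StronglyMeasurable h)
    (hfin : ∫⁻ p, ENNReal.ofReal (B |h p|) ∂((volume.restrict Ω).prod (torusMeasure N)) < ∞) :
    MemOrliczPer₃ B Ω (periodize h) := by
  have hq : Measurable (Prod.map id toTorus : E N × E N × E N → E N × Torus N) :=
    measurable_id.prodMap continuous_toTorus.measurable
  have hum : StronglyMeasurable (periodize h) := hh.comp_measurable hq
  have hG : Measurable fun p => ENNReal.ofReal (B |h p|) :=
    (hB.continuous_abs.measurable.comp hh.measurable).ennreal_ofReal
  have hGu : Measurable fun p => ENNReal.ofReal (B |periodize h p|) := hG.comp hq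
  refine ⟨fun K hKΩ hK => ?_, ?_, ?_⟩
  · refine hB.memOrlicz_of_lintegral_lt_top hum.aestronglyMeasurable ?_
    have hK2 : Bornology.IsBounded (Prod.snd '' K) := (hK.image continuous_snd).isBounded
    obtain ⟨c, hc, hle⟩ := exists_lintegral_toTorus_le hK2
    have hsub : K ⊆ Ω ×ˢ (Prod.snd '' K) := fun p hp => ⟨(hKΩ hp).1, mem_image_of_mem _ hp⟩
    refine (lintegral_mono_set hsub).trans_lt ?_
    rw [Measure.volume_eq_prod, ← Measure.prod_restrict, lintegral_prod _ hGu.aemeasurable]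
    refine (lintegral_mono fun x => hle (fun s => ENNReal.ofReal (B |h (x, s)|))
      (hG.comp measurable_prodMk_left)).trans_lt ?_
    rw [lintegral_const_mul' _ _ hc, ← lintegral_prod _ hG.aemeasurable]
    exact ENNReal.mul_lt_top hc.lt_top hfin
  · rw [lintegral_prod _ hG.aemeasurable] at hfin
    filter_upwards [ae_lt_top hG.lintegral_prod_right' hfin.ne] with x hx
    refine ⟨fun K _ hK => hB.memOrlicz_of_lintegral_lt_top
      (hum.comp_measurable measurable_prodMk_left).aestronglyMeasurable ?_,
      fun k l => Eventually.of_forall fun q => ?_⟩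
    · obtain ⟨c, hc, hle⟩ := exists_lintegral_toTorus_le hK.isBounded
      exact (hle (fun s => ENNReal.ofReal (B |h (x, s)|))
        (hG.comp measurable_prodMk_left)).trans_lt (ENNReal.mul_lt_top hc.lt_top hx)
    · simp only [periodize, toTorus_add_intVec]
  · rw [← map_prod_toTorus_cell, lintegral_map hG hq] at hfin
    exact hfin

end PeriodicLimit

end ReiteratedOrlicz

theorem proposition2p2 (N : ℕ) (B : ℝ → ℝ) (hB : ReiteratedOrlicz.IsNFunction B)
    (hB2 : ReiteratedOrlicz.Delta2 B) (hBc2 : ReiteratedOrlicz.Delta2 (ReiteratedOrlicz.conj B))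
    (Ω : Set (ReiteratedOrlicz.E N)) (hΩ : IsOpen Ω) (hΩb : Bornology.IsBounded Ω)
    (ε : ℕ → ℝ) (hε : ∀ n, 0 < ε n) (hε0 : Tendsto ε atTop (𝓝 0))
    (u : ℕ → ReiteratedOrlicz.E N → ℝ)
    (hu : ∀ n, ReiteratedOrlicz.MemOrlicz B (volume.restrict Ω) (u n))
    (hbdd : ∃ C : ℝ≥0, ∀ n, ReiteratedOrlicz.luxNorm B (volume.restrict Ω) (u n) ≤ C) :
    ∃ φ : ℕ → ℕ, StrictMono φ ∧
      ∃ u₀ : ReiteratedOrlicz.E N × ReiteratedOrlicz.E N × ReiteratedOrlicz.E N → ℝ,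
        ReiteratedOrlicz.WeakReiteratedTwoScale B Ω (ε ∘ φ) (u ∘ φ) u₀ := by
  open ReiteratedOrlicz in
  have : IsFiniteMeasure (volume.restrict Ω) := ⟨by
    rw [Measure.restrict_apply_univ]
    exact hΩb.measure_lt_top⟩
  obtain ⟨C, hC⟩ := hbdd
  -- The infimum in the Luxemburg norm need not be attained, hence a constant larger than `C`.
  set K : ℝ := C + 1 with hKdef
  have hK : 0 < K := by positivity
  have hle : ∀ n, ∫⁻ x in Ω, ENNReal.ofReal (B (|u n x| / K)) ≤ 1 := fun n =>
    hB.lintegral_le_one_of_luxNorm_lt ((hC n).trans_lt (by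
      rw [← ENNReal.ofReal_coe_nnreal]
      exact (ENNReal.ofReal_lt_ofReal_iff hK).2 (lt_add_one _)))
  have huB := fun n => hB.integrable_modular (hu n).1 hK (hle n)
  obtain ⟨φ, hφ, h, hh, hmod, hlim⟩ := hB.exists_subseq_tendsto
    (mixing_scalePoint hε hε0 hΩ.measurableSet) hK (fun n => (hu n).1) (fun n => (huB n).1)
    fun n => (huB n).2
  have hfin : ∫⁻ p, ENNReal.ofReal (B |h p|)
      ∂((volume.restrict Ω).prod (torusMeasure N)) < ∞ := by
    have h1 := hB2.lintegral_lt_top (μ := (volume.restrict Ω).prod (torusMeasure N)) hB.monotoneOn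
      (g := fun p => |h p|) (fun p => abs_nonneg _) (δ := K⁻¹) (by positivity)
      (by simpa only [div_eq_inv_mul] using hmod.trans_lt ENNReal.one_lt_top) zero_le_one
    simpa only [one_mul] using h1
  refine ⟨φ, hφ, periodize h, fun n => hu (φ n), hB.memOrliczPer₃_periodize hh hfin, fun f hf => ?_⟩
  have hDm : AEStronglyMeasurable (fun x => descend (f x)) (volume.restrict Ω) :=
    continuous_descend.comp_aestronglyMeasurable hf.1
  have hDB : ∀ c : ℝ, 0 < c →
      Integrable (fun x => conj B (c * ‖descend (f x)‖)) (volume.restrict Ω) := by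
    intro c hc
    obtain ⟨δ, hδ, hδfin⟩ := hf.2.exists_lintegral_lt_top
    have h1 := hBc2.lintegral_lt_top (hB.conj_mono.monotoneOn _) (fun x => abs_nonneg _) hδ hδfin
      hc.le
    refine ⟨hB.continuous_conj.comp_aestronglyMeasurable (hDm.norm.const_mul c), ?_⟩
    rw [hasFiniteIntegral_iff_ofReal (Eventually.of_forall fun x => hB.conj_nonneg _)]
    refine (lintegral_mono fun x => ENNReal.ofReal_le_ofReal (hB.conj_mono ?_)).trans_lt h1
    rw [abs_of_nonneg (norm_nonneg (f x))]
    exact mul_le_mul_of_nonneg_left (norm_descend_le _) hc.le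
  have hq : Measurable (Prod.map id toTorus : E N × E N × E N → E N × Torus N) :=
    measurable_id.prodMap continuous_toTorus.measurable
  have hlimit : ∫ p in Ω ×ˢ cell N ×ˢ cell N, periodize h p *
      (f p.1 : BoundedContinuousFunction (E N × E N) ℝ) p.2 =
      ∫ p, h p * descend (f p.1) p.2 ∂((volume.restrict Ω).prod (torusMeasure N)) := by
    have hm : AEStronglyMeasurable (fun p : E N × Torus N => h p * descend (f p.1) p.2)
        ((volume.restrict Ω).prod (torusMeasure N)) :=
      hh.aestronglyMeasurable.mul (aestronglyMeasurable_eval hDm)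
    rw [← map_prod_toTorus_cell] at hm ⊢
    rw [integral_map hq.aemeasurable hm]
    simp only [Prod.map_fst, Prod.map_snd, id, descend_toTorus]
    rfl
  rw [hlimit]
  refine (hlim _ hDm hDB).congr fun j => ?_
  simp only [scalePoint, descend_toTorus]
  rfl
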